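/- **Setting.** A schema consists of tables with typed columns (integers, decimals, strings); there are no NULLs and no integrity constraints. A database instance assigns a finite bag of rows to every table. There are infinitely many aliases. A *flat* query consists of the clauses FROM (a list of table references, each an alias with a table), WHERE (a condition $P$) and SELECT (a list of expressions, possibly with DISTINCT). A *grouped* query has in addition a GROUP BY list $\vec o$ of aggregation-free expressions (possibly empty) and a HAVING condition $H$, and its HAVING and SELECT clauses may use (DISTINCT) COUNT, SUM, AVG, MIN, MAX. Conditions are syntax trees built with AND, OR, NOT from TRUE, FALSE and atomic predicates (comparisons and LIKE). The tuples of the cross product of the FROM tables that satisfy $P$ are, for a grouped query, partitioned by the values of $\vec o$ into nonempty groups, and the groups that satisfy $H$ are kept; SELECT yields one result row for each tuple or each kept group, under bag semantics. $Q\equiv Q'$ means that both yield the same bag of rows over every database instance. Queries are assumed well-formed: FROM and SELECT are nonempty, aliases are distinct, column references resolve to the FROM clause, and an expression that HAVING or SELECT uses outside aggregate calls has a single value in every group. Let $Q$ (the working query) and $Q^\star$ (the target) be both flat or both grouped. The *stages* are FROM, WHERE, SELECT for flat queries and FROM, WHERE, GROUP BY, HAVING, SELECT for grouped ones, numbered $1,2,\dots$;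 each stage focuses on the clause it is named after (DISTINCT belongs to SELECT). From stage 2 on, $Q^\star$ is replaced by a *unified* target $T$, with clauses $P_T,\vec o_T,H_T,\dots$: its aliases are renamed by a bijection onto those of the working query that preserves the tables they stand for, and for grouped queries conditions may then be legally moved between WHERE and HAVING (a condition may be moved if it has a single truth value in each group). Fix a set $\mathcal C$ of interpretations of the aggregate functions that contains the actual one (the models of a sound set of inference rules for aggregates). **Viability checks.** The query being checked has clauses $P,\vec o,H,\dots$ * FROM: it references the same multiset of tables as $Q^\star$. * WHERE: $P\Leftrightarrow P_T$ on all tuples. * GROUP BY: any two tuples $t_1,t_2$ satisfying $P_T$ agree on $\vec o$ if and only if they agree on $\vec o_T$. * HAVING: $H\Leftrightarrow H_T$ on every group (a nonempty bag of tuples that satisfy $P$ and agree on $\vec o$), for every interpretation in $\mathcal C$. * SELECT: DISTINCT is used in both queries or in neither, the SELECT lists have equal length, and at each position their expressions have the same type and are equal on all tuples satisfying $P$ (flat), respectively on every group for every interpretation in $\mathcal C$ (grouped). **Hints.** The hints use a solver whose answers "unsatisfiable" are correct (any other answer means "satisfiable or unknown"; no completeness is assumed) and a procedure that minimizes partial Boolean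 functions and returns a Boolean expression with the prescribed values. That $p$ implies $q$ is *established* if $p$ is FALSE, or $q$ is TRUE, or the solver reports $p\wedge\neg q$ unsatisfiable. * FROM: for every table whose number of references differs from that in $Q^\star$, use it more or less often, so as to equal that number. A query follows the hint if, for every table, its number of references equals that in $Q^\star$, and references were only added, or only removed, or left unchanged, accordingly. * WHERE, HAVING: a *repair* of the condition $P$ (respectively $H$), that is, a set $s$ of disjoint subtrees with a replacement (a *fix*) for each; the hint is followed by applying it. It is found as follows. Let $P^\star$ be the corresponding condition of $T$. Go through all sets $s$ of at most $n$ disjoint subtrees ($n\ge 1$ fixed) by ascending $|s|$, stopping as soon as $w\,|s|$ ($w>0$ fixed) is at least the least cost found. The *repair bounds* $[l,u]$ of a node are $[\mathrm{FALSE},\mathrm{TRUE}]$ at a subtree in $s$, $[x,x]$ at any other leaf $x$, $[\neg u',\neg l']$ at the negation of a node with bounds $[l',u']$, and the conjunctions (disjunctions) of the children's lower and upper bounds at an AND (OR) node. If $l\Rightarrow P^\star$ and $P^\star\Rightarrow u$ are established for the bounds at the root, derive the fixes. To this end the target bound $[P^\star,P^\star]$ at the root is pushed down the tree: $[l^\star,u^\star]$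 becomes $[\neg u^\star,\neg l^\star]$ below a negation; for a child with repair bounds $[l_c,u_c]$ whose siblings have combined bounds $[l',u']$ it becomes $[l^\star,\;u_c\wedge(u^\star\vee\neg u')]$ below AND and $[l_c\vee(l^\star\wedge\neg l'),\;u^\star]$ below OR. The children of a node that belong to $s$ are treated as one child with bounds $[\mathrm{FALSE},\mathrm{TRUE}]$, and the clauses of their joint fix (at the operator of the node) are distributed among them in an arbitrary way. A fix for a target bound $[l^\star,u^\star]$ is obtained by choosing among the atomic predicates of $l^\star$ and $u^\star$ some that express all the others, up to equivalence or negation, as established by the solver, and by minimizing the partial Boolean function of the chosen ones whose value is the common value of $l^\star$ and $u^\star$ where these agree, and is a don't-care where they differ and where the solver reports the truth assignment unsatisfiable. A repair $(s,F)$ has cost $w\,|s|+\sum_{x\in s}(|x|+|F(x)|)/(|P|+|P^\star|)$, where $|\cdot|$ counts nodes; the first repair of least cost found is returned. For HAVING, the solver works relative to the groups determined by $P$ and $\vec o$ and to $\mathcal C$. * GROUP BY: remove $\Delta^-$ from $\vec o$ and add $\Delta^+$. $\Delta^-$ consists of the expressions of $\vec o$ for which the solver cannot exclude two tuples that satisfy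 $P_T$, agree on $\vec o_T$ and differ on the expression. Then go through $\vec o_T$ in order: an expression is put into $\Delta^+$ if the solver cannot exclude two tuples that satisfy $P_T$, agree on the remaining expressions of $\vec o$ and on those already in $\Delta^+$, and differ on the expression. * SELECT: use DISTINCT exactly if the target does; replace each expression that is not established to be equal to the target expression at the same position (on the tuples satisfying $P$, respectively on the groups) by the latter; drop excess expressions and append missing ones. Two queries are *stage-$k$ consistent* if they are syntactically identical except in the fragments that the stages after $k$ focus on. **Theorem.** For each stage $i$ (and, if $i\ge2$, every unified target $T$) the following hold. * *(Hint leads to fix)* For every well-formed working query $Q_{i-1}$ that satisfies the viability checks $V_1,\dots,V_{i-1}$ of the stages before $i$ but not $V_i$, there is a well-formed query $\hat Q_i$ that satisfies $V_1,\dots,V_i$, is stage-$(i-1)$ consistent with $Q_{i-1}$, and follows the stage-$i$ hint. * *(Fix leads to eventual correctness)* For every well-formed working query $Q_i$ that satisfies $V_1,\dots,V_i$, there is a well-formed query $\hat Q\equiv Q^\star$ that is stage-$i$ consistent with $Q_i$. -/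

import Mathlib

noncomputable section

open scoped Classical

namespace SQL

/-! ## Data: types, schemas, rows, database instances -/

/-- Column types (no `NULL` values). -/
inductive Ty
  | int | dec | str

@[reducible] def Ty.Val : Ty → Type
  | .int => ℤ
  | .dec => ℚ
  | .str => String

instance Ty.instLinearOrderVal (τ : Ty) : LinearOrder τ.Val :=
  match τ with
  | .int => inferInstanceAs (LinearOrder ℤ)
  | .dec => inferInstanceAs (LinearOrder ℚ)
  | .str => inferInstanceAs (LinearOrder String)

instance Ty.instInhabitedVal (τ : Ty) : Inhabited τ.Val :=
  match τ with
  | .int => inferInstanceAs (Inhabited ℤ)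
  | .dec => inferInstanceAs (Inhabited ℚ)
  | .str => inferInstanceAs (Inhabited String)

/-- A database schema: tables and their typed columns. There are no keys or other constraints. -/
structure Schema where
  Table : Type
  Col : Table → Type
  ty : (T : Table) → Col T → Ty

abbrev Row (S : Schema) (T : S.Table) : Type := (c : S.Col T) → (S.ty T c).Val

/-- A database instance: every table holds a finite bag of rows. -/
abbrev Database (S : Schema) : Type := (T : S.Table) → Multiset (Row S T)

/-- An assignment of a row to each table reference (alias, table), that is, an assignment of a
value to each column reference. Tuples of a `FROM` cross product are such assignments, with default
values at the references that do not occur in the `FROM` clause. -/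
abbrev Env (S : Schema) (A : Type) : Type := A → (T : S.Table) → Row S T

/-! ## Scalar expressions, aggregate expressions, atomic predicates -/

/-- Unary scalar functions. -/
inductive Fn₁ : Ty → Ty → Type
  | ineg : Fn₁ .int .int
  | dneg : Fn₁ .dec .dec
  | toDec : Fn₁ .int .dec
  | len : Fn₁ .str .int

def Fn₁.eval : {σ τ : Ty} → Fn₁ σ τ → σ.Val → τ.Val
  | _, _, .ineg, x => -(x : ℤ)
  | _, _, .dneg, x => -(x : ℚ)
  | _, _, .toDec, x => ((x : ℤ) : ℚ)
  | _, _, .len, x => (String.length x : ℤ)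

/-- Binary scalar functions (division by zero gives zero). -/
inductive Fn₂ : Ty → Ty → Ty → Type
  | iadd : Fn₂ .int .int .int
  | isub : Fn₂ .int .int .int
  | imul : Fn₂ .int .int .int
  | idiv : Fn₂ .int .int .int
  | dadd : Fn₂ .dec .dec .dec
  | dsub : Fn₂ .dec .dec .dec
  | dmul : Fn₂ .dec .dec .dec
  | ddiv : Fn₂ .dec .dec .dec
  | concat : Fn₂ .str .str .str

def Fn₂.eval : {σ₁ σ₂ τ : Ty} → Fn₂ σ₁ σ₂ τ → σ₁.Val → σ₂.Val → τ.Val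
  | _, _, _, .iadd, x, y => (x + y : ℤ)
  | _, _, _, .isub, x, y => (x - y : ℤ)
  | _, _, _, .imul, x, y => (x * y : ℤ)
  | _, _, _, .idiv, x, y => Int.tdiv x y
  | _, _, _, .dadd, x, y => (x + y : ℚ)
  | _, _, _, .dsub, x, y => (x - y : ℚ)
  | _, _, _, .dmul, x, y => (x * y : ℚ)
  | _, _, _, .ddiv, x, y => (x / y : ℚ)
  | _, _, _, .concat, x, y => String.append x y

/-- Aggregation-free value expressions; `col a T c` is the reference `a.c` to the column `c` of
the table `T` that the alias `a` stands for. -/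
inductive Expr (S : Schema) (A : Type) : Ty → Type
  | lit {τ : Ty} (v : τ.Val) : Expr S A τ
  | col (a : A) (T : S.Table) (c : S.Col T) : Expr S A (S.ty T c)
  | app₁ {σ τ : Ty} (f : Fn₁ σ τ) (e : Expr S A σ) : Expr S A τ
  | app₂ {σ₁ σ₂ τ : Ty} (f : Fn₂ σ₁ σ₂ τ) (e₁ : Expr S A σ₁) (e₂ : Expr S A σ₂) : Expr S A τ

/-- Aggregate functions; `COUNT(*)` is `COUNT` of a literal. -/
inductive AggFn : Ty → Ty → Type
  | count (σ : Ty) : AggFn σ .int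
  | isum : AggFn .int .int
  | dsum : AggFn .dec .dec
  | iavg : AggFn .int .dec
  | davg : AggFn .dec .dec
  | min (σ : Ty) : AggFn σ σ
  | max (σ : Ty) : AggFn σ σ

/-- An interpretation of the aggregate functions on bags of values. -/
abbrev AggInterp : Type := (σ τ : Ty) → AggFn σ τ → Multiset σ.Val → τ.Val

/-- The actual meaning of the aggregate functions (they are only ever applied to nonempty bags). -/
def stdAgg : AggInterp
  | _, _, .count _, m => (Multiset.card m : ℤ)
  | _, _, .isum, m => (Multiset.sum (M := ℤ) m)
  | _, _, .dsum, m => (Multiset.sum (M := ℚ) m)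
  | _, _, .iavg, m => ((Multiset.sum (M := ℤ) m : ℤ) : ℚ) / (Multiset.card m : ℚ)
  | _, _, .davg, m => (Multiset.sum (M := ℚ) m) / (Multiset.card m : ℚ)
  | _, _, .min _, m => ((m.sort (· ≤ ·)).head?).getD default
  | _, _, .max _, m => ((m.sort (· ≤ ·)).getLast?).getD default

/-- Expressions of the `HAVING` and `SELECT` clauses of a grouped query: `row e` is an
aggregation-free expression used outside aggregate calls, `agg f true e` is `f(DISTINCT e)`. -/
inductive GExpr (S : Schema) (A : Type) : Ty → Type
  | row {τ : Ty} (e : Expr S A τ) : GExpr S A τ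
  | agg {σ τ : Ty} (f : AggFn σ τ) (distinct : Bool) (e : Expr S A σ) : GExpr S A τ
  | app₁ {σ τ : Ty} (f : Fn₁ σ τ) (e : GExpr S A σ) : GExpr S A τ
  | app₂ {σ₁ σ₂ τ : Ty} (f : Fn₂ σ₁ σ₂ τ) (e₁ : GExpr S A σ₁) (e₂ : GExpr S A σ₂) : GExpr S A τ

variable {S : Schema} {A B : Type}

def Expr.eval (ρ : Env S A) : {τ : Ty} → Expr S A τ → τ.Val
  | _, .lit v => v
  | _, .col a T c => ρ a T c
  | _, .app₁ f e => f.eval (e.eval ρ)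
  | _, .app₂ f e₁ e₂ => f.eval (e₁.eval ρ) (e₂.eval ρ)

/-- The table references of an expression. -/
def Expr.refs : {τ : Ty} → Expr S A τ → Set (A × S.Table)
  | _, .lit _ => ∅
  | _, .col a T _ => {(a, T)}
  | _, .app₁ _ e => e.refs
  | _, .app₂ _ e₁ e₂ => e₁.refs ∪ e₂.refs

def Expr.rename (m : A → B) : {τ : Ty} → Expr S A τ → Expr S B τ
  | _, .lit v => .lit v
  | _, .col a T c => .col (m a) T c
  | _, .app₁ f e => .app₁ f (e.rename m)
  | _, .app₂ f e₁ e₂ => .app₂ f (e₁.rename m) (e₂.rename m)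

/-- The row of a group at which aggregation-free expressions are read off. -/
def rep (g : Multiset (Env S A)) : Env S A :=
  if h : ∃ ρ, ρ ∈ g then h.choose else default

def GExpr.eval (I : AggInterp) (g : Multiset (Env S A)) : {τ : Ty} → GExpr S A τ → τ.Val
  | _, .row e => e.eval (rep g)
  | _, .agg f d e =>
      I _ _ f (if d then (g.map fun ρ => e.eval ρ).dedup else g.map fun ρ => e.eval ρ)
  | _, .app₁ f e => f.eval (e.eval I g)
  | _, .app₂ f e₁ e₂ => f.eval (e₁.eval I g) (e₂.eval I g)

def GExpr.refs : {τ : Ty} → GExpr S A τ → Set (A × S.Table)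
  | _, .row e => e.refs
  | _, .agg _ _ e => e.refs
  | _, .app₁ _ e => e.refs
  | _, .app₂ _ e₁ e₂ => e₁.refs ∪ e₂.refs

def GExpr.rename (m : A → B) : {τ : Ty} → GExpr S A τ → GExpr S B τ
  | _, .row e => .row (e.rename m)
  | _, .agg f d e => .agg f d (e.rename m)
  | _, .app₁ f e => .app₁ f (e.rename m)
  | _, .app₂ f e₁ e₂ => .app₂ f (e₁.rename m) (e₂.rename m)

/-- The aggregation-free expressions that occur outside aggregate calls. -/
def GExpr.rowParts : {τ : Ty} → GExpr S A τ → Set (Σ σ : Ty, Expr S A σ)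
  | τ, .row e => {⟨τ, e⟩}
  | _, .agg _ _ _ => ∅
  | _, .app₁ _ e => e.rowParts
  | _, .app₂ _ e₁ e₂ => e₁.rowParts ∪ e₂.rowParts

inductive CmpOp
  | eq | ne | lt | le | gt | ge

def CmpOp.Holds {τ : Ty} (x y : τ.Val) : CmpOp → Prop
  | .eq => x = y
  | .ne => x ≠ y
  | .lt => x < y
  | .le => x ≤ y
  | .gt => y < x
  | .ge => y ≤ x

/-- `s LIKE p`: the character with code 37 (percent) matches any string and the character with
code 95 (underscore) matches any single character. -/
def likeMatch : List Char → List Char → Prop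
  | [], s => s = []
  | p :: ps, s =>
      if p = Char.ofNat 37 then ∃ k, likeMatch ps (s.drop k)
      else ∃ c cs, s = c :: cs ∧ (p = Char.ofNat 95 ∨ p = c) ∧ likeMatch ps cs

/-- Atomic predicates over a family `E` of typed expressions. -/
inductive Atom (E : Ty → Type)
  | cmp {τ : Ty} (op : CmpOp) (e₁ e₂ : E τ) : Atom E
  | like (e pattern : E .str) : Atom E

def Atom.Holds {E : Ty → Type} (val : (τ : Ty) → E τ → τ.Val) : Atom E → Prop
  | .cmp op e₁ e₂ => op.Holds (val _ e₁) (val _ e₂)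
  | .like e p => likeMatch (String.toList (val .str p)) (String.toList (val .str e))

def Atom.map {E F : Ty → Type} (f : (τ : Ty) → E τ → F τ) : Atom E → Atom F
  | .cmp op e₁ e₂ => .cmp op (f _ e₁) (f _ e₂)
  | .like e p => .like (f _ e) (f _ p)

/-- The union of a set-valued attribute over the two expressions of an atomic predicate. -/
def Atom.collect {E : Ty → Type} {X : Type} (f : (τ : Ty) → E τ → Set X) : Atom E → Set X
  | .cmp _ e₁ e₂ => f _ e₁ ∪ f _ e₂
  | .like e p => f _ e ∪ f _ p

/-- Atomic predicates of `WHERE` conditions. -/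
abbrev RAtom (S : Schema) (A : Type) : Type := Atom (Expr S A)

/-- Atomic predicates of `HAVING` conditions. -/
abbrev GAtom (S : Schema) (A : Type) : Type := Atom (GExpr S A)

/-! ## Syntax trees of conditions -/

inductive Conn
  | and | or

/-- Syntax trees: leaves are `TRUE`, `FALSE` and atomic predicates, internal nodes are negations
and conjunctions or disjunctions of any number of children. -/
inductive Fml (α : Type)
  | tru : Fml α
  | fls : Fml α
  | atom (a : α) : Fml α
  | not (f : Fml α) : Fml α
  | node (op : Conn) (n : ℕ) (c : Fin n → Fml α) : Fml α

variable {α β : Type}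

namespace Fml

def Eval (v : α → Prop) : Fml α → Prop
  | .tru => True
  | .fls => False
  | .atom a => v a
  | .not f => ¬ f.Eval v
  | .node .and _ c => ∀ i, (c i).Eval v
  | .node .or _ c => ∃ i, (c i).Eval v

/-- Substitution of formulas for atoms. -/
def bind (s : α → Fml β) : Fml α → Fml β
  | .tru => .tru
  | .fls => .fls
  | .atom a => s a
  | .not f => .not (f.bind s)
  | .node op n c => .node op n fun i => (c i).bind s

def map (s : α → β) (f : Fml α) : Fml β := f.bind fun a => .atom (s a)

def atoms : Fml α → List α
  | .tru => []
  | .fls => []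
  | .atom a => [a]
  | .not f => f.atoms
  | .node _ n c => (List.finRange n).flatMap fun i => (c i).atoms

/-- The number of nodes. -/
def size : Fml α → ℕ
  | .tru => 1
  | .fls => 1
  | .atom _ => 1
  | .not f => 1 + f.size
  | .node _ _ c => 1 + ∑ i, (c i).size

def big (op : Conn) (l : List (Fml α)) : Fml α := .node op l.length l.get

def conj (p q : Fml α) : Fml α := big .and [p, q]

def disj (p q : Fml α) : Fml α := big .or [p, q]

end Fml

/-- Meaning of a `WHERE` condition at a tuple. -/
def RowHolds (ρ : Env S A) (P : Fml (RAtom S A)) : Prop :=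
  P.Eval fun a => a.Holds fun _ e => e.eval ρ

/-- Meaning of a `HAVING` condition at a group. -/
def GroupHolds (I : AggInterp) (g : Multiset (Env S A)) (H : Fml (GAtom S A)) : Prop :=
  H.Eval fun a => a.Holds fun _ e => e.eval I g

/-! ## Queries and their results -/

abbrev From (S : Schema) (A : Type) : Type := List (A × S.Table)

abbrev Exprs (S : Schema) (A : Type) : Type := List (Σ τ : Ty, Expr S A τ)

abbrev GExprs (S : Schema) (A : Type) : Type := List (Σ τ : Ty, GExpr S A τ)

/-- The bag of tuples of the cross product of the `FROM` tables. -/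
def From.rows (D : Database S) : From S A → Multiset (Env S A)
  | [] => {default}
  | (a, T) :: F =>
      (D T).bind fun r =>
        (From.rows D F).map fun ρ => Function.update ρ a (Function.update (ρ a) T r)

/-- The multiset of tables of a `FROM` clause. -/
def From.tables (F : From S A) : Multiset S.Table := Multiset.map Prod.snd (F : Multiset (A × S.Table))

/-- The set of aliases of a `FROM` clause. -/
def From.aliases (F : From S A) : Set A := {a | ∃ T, (a, T) ∈ F}

/-- The values of a list of expressions at a tuple. -/
def Exprs.eval (ρ : Env S A) (o : Exprs S A) : List (Σ τ : Ty, τ.Val) :=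
  o.map fun e => ⟨e.1, e.2.eval ρ⟩

/-- The values of a list of expressions at a group. -/
def GExprs.eval (I : AggInterp) (g : Multiset (Env S A)) (o : GExprs S A) :
    List (Σ τ : Ty, τ.Val) :=
  o.map fun e => ⟨e.1, e.2.eval I g⟩

/-- A query without grouping and aggregation. -/
structure FlatQuery (S : Schema) (A : Type) where
  frm : From S A
  cond : Fml (RAtom S A)
  distinct : Bool
  select : Exprs S A

/-- A query with a single level of grouping and aggregation; a query that aggregates without a
`GROUP BY` clause has `keys = []`. -/
structure GroupedQuery (S : Schema) (A : Type) where
  frm : From S A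
  cond : Fml (RAtom S A)
  keys : Exprs S A
  having : Fml (GAtom S A)
  distinct : Bool
  select : GExprs S A

/-- The bag of tuples selected by `FROM` and `WHERE`. -/
def fromWhere (D : Database S) (F : From S A) (P : Fml (RAtom S A)) : Multiset (Env S A) :=
  (From.rows D F).filter fun ρ => RowHolds ρ P

/-- The partition of a bag of tuples by the values of the `GROUP BY` expressions. -/
def partition (o : Exprs S A) (R : Multiset (Env S A)) : Multiset (Multiset (Env S A)) :=
  (R.map fun ρ => o.eval ρ).dedup.map fun k => R.filter fun ρ => o.eval ρ = k

/-- The bag of result rows. -/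
def FlatQuery.result (Q : FlatQuery S A) (D : Database S) : Multiset (List (Σ τ : Ty, τ.Val)) :=
  let out := (fromWhere D Q.frm Q.cond).map fun ρ => Q.select.eval ρ
  if Q.distinct then out.dedup else out

/-- The bag of result rows. -/
def GroupedQuery.result (Q : GroupedQuery S A) (D : Database S) :
    Multiset (List (Σ τ : Ty, τ.Val)) :=
  let groups := (partition Q.keys (fromWhere D Q.frm Q.cond)).filter
    fun g => GroupHolds stdAgg g Q.having
  let out := groups.map fun g => Q.select.eval stdAgg g
  if Q.distinct then out.dedup else out

/-- Equivalence: the same bag of result rows over every database instance. -/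
def FlatQuery.Equiv (Q Q' : FlatQuery S A) : Prop := ∀ D, Q.result D = Q'.result D

/-- Equivalence: the same bag of result rows over every database instance. -/
def GroupedQuery.Equiv (Q Q' : GroupedQuery S A) : Prop := ∀ D, Q.result D = Q'.result D

/-- `g` can be a group of a query with `WHERE` condition `P` and `GROUP BY` list `o`: a nonempty
bag of tuples that satisfy `P` and agree on `o`. -/
def IsGroup (P : Fml (RAtom S A)) (o : Exprs S A) (g : Multiset (Env S A)) : Prop :=
  g ≠ 0 ∧ (∀ ρ ∈ g, RowHolds ρ P) ∧ ∀ ρ₁ ∈ g, ∀ ρ₂ ∈ g, o.eval ρ₁ = o.eval ρ₂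

/-- All the given table references resolve to the `FROM` clause. -/
def From.Covers (F : From S A) (r : Set (A × S.Table)) : Prop := ∀ x ∈ r, x ∈ F

/-- Well-formed `FROM` and `WHERE` clauses: distinct aliases, resolved references. -/
def ValidFromWhere (F : From S A) (P : Fml (RAtom S A)) : Prop :=
  F ≠ [] ∧ (F.map Prod.fst).Nodup ∧
    ∀ a ∈ P.atoms, F.Covers (a.collect fun _ e => e.refs)

/-- Well-formed queries. -/
def FlatQuery.Valid (Q : FlatQuery S A) : Prop :=
  ValidFromWhere Q.frm Q.cond ∧ Q.select ≠ [] ∧ ∀ e ∈ Q.select, Q.frm.Covers e.2.refs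

/-- The value of `e` is the same throughout every group (for instance, because `e` is a literal or
one of the `GROUP BY` expressions). -/
def Determined (P : Fml (RAtom S A)) (o : Exprs S A) (e : Σ τ : Ty, Expr S A τ) : Prop :=
  ∀ ρ₁ ρ₂, RowHolds ρ₁ P → RowHolds ρ₂ P → o.eval ρ₁ = o.eval ρ₂ → e.2.eval ρ₁ = e.2.eval ρ₂

/-- Well-formed queries; every aggregation-free expression that `HAVING` or `SELECT` uses outside
aggregate calls must have a single value per group. -/
def GroupedQuery.Valid (Q : GroupedQuery S A) : Prop :=
  ValidFromWhere Q.frm Q.cond ∧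
  (∀ e ∈ Q.keys, Q.frm.Covers e.2.refs) ∧
  (∀ a ∈ Q.having.atoms, Q.frm.Covers (a.collect fun _ e => e.refs) ∧
    ∀ x ∈ a.collect fun _ e => e.rowParts, Determined Q.cond Q.keys x) ∧
  Q.select ≠ [] ∧
  ∀ e ∈ Q.select, Q.frm.Covers e.2.refs ∧ ∀ x ∈ e.2.rowParts, Determined Q.cond Q.keys x

/-! ## Unification of the target query with the working query -/

/-- A table mapping: a bijection between the aliases of two `FROM` clauses that preserves the
associated tables. -/
def IsTableMapping (m : A → A) (Fs F : From S A) : Prop :=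
  Set.BijOn m Fs.aliases F.aliases ∧ ∀ a T, (a, T) ∈ Fs → (m a, T) ∈ F

def From.rename (m : A → A) (F : From S A) : From S A := F.map fun x => (m x.1, x.2)

def renameExprs (m : A → A) (o : Exprs S A) : Exprs S A := o.map fun e => ⟨e.1, e.2.rename m⟩

def renameGExprs (m : A → A) (o : GExprs S A) : GExprs S A := o.map fun e => ⟨e.1, e.2.rename m⟩

def FlatQuery.rename (m : A → A) (Q : FlatQuery S A) : FlatQuery S A where
  frm := Q.frm.rename m
  cond := Q.cond.map (Atom.map fun _ e => e.rename m)
  distinct := Q.distinct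
  select := renameExprs m Q.select

def GroupedQuery.rename (m : A → A) (Q : GroupedQuery S A) : GroupedQuery S A where
  frm := Q.frm.rename m
  cond := Q.cond.map (Atom.map fun _ e => e.rename m)
  keys := renameExprs m Q.keys
  having := Q.having.map (Atom.map fun _ e => e.rename m)
  distinct := Q.distinct
  select := renameGExprs m Q.select

/-- `q'` arises from `q` by legally moving a condition `c` from `WHERE` to `HAVING`: `c` has a
single truth value in each group of `q'`. -/
def MovesCondition (q q' : GroupedQuery S A) : Prop :=
  q'.frm = q.frm ∧ q'.keys = q.keys ∧ q'.distinct = q.distinct ∧ q'.select = q.select ∧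
  ∃ c : Fml (RAtom S A),
    (∀ ρ, RowHolds ρ q.cond ↔ RowHolds ρ q'.cond ∧ RowHolds ρ c) ∧
    (∀ ρ₁ ρ₂, RowHolds ρ₁ q'.cond → RowHolds ρ₂ q'.cond → q.keys.eval ρ₁ = q.keys.eval ρ₂ →
      (RowHolds ρ₁ c ↔ RowHolds ρ₂ c)) ∧
    (∀ g, IsGroup q'.cond q'.keys g →
      (GroupHolds stdAgg g q'.having ↔
        GroupHolds stdAgg g q.having ∧
          GroupHolds stdAgg g (c.map (Atom.map fun _ e => GExpr.row e))))

/-- `T` is the target `Qs` with its aliases renamed to those of the working query by some table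
mapping. -/
def FlatQuery.Unifies (Qs Q T : FlatQuery S A) : Prop :=
  ∃ m, IsTableMapping m Qs.frm Q.frm ∧ T = Qs.rename m

/-- `T` is the target `Qs` with its aliases renamed to those of the working query by some table
mapping, possibly followed by legal moves of conditions between `WHERE` and `HAVING`. -/
def GroupedQuery.Unifies (Qs Q T : GroupedQuery S A) : Prop :=
  T.Valid ∧ ∃ m, IsTableMapping m Qs.frm Q.frm ∧
    Relation.ReflTransGen (fun q q' => MovesCondition q q' ∨ MovesCondition q' q)
      (Qs.rename m) T

/-! ## Viability checks -/

/-- The viability checks of the stages `FROM`, `WHERE`, `SELECT` (numbered `0, 1, 2`) for the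
working query `Q`, the target `Qs` and its unified form `T`. -/
def FlatQuery.Viable (Qs T Q : FlatQuery S A) (i : Fin 3) : Prop :=
  match i with
  | 0 => Q.frm.tables = Qs.frm.tables
  | 1 => ∀ ρ, RowHolds ρ Q.cond ↔ RowHolds ρ T.cond
  | 2 => Q.distinct = T.distinct ∧ Q.select.length = T.select.length ∧
      ∀ ρ, RowHolds ρ Q.cond → Q.select.eval ρ = T.select.eval ρ

/-- The viability checks of the stages `FROM`, `WHERE`, `GROUP BY`, `HAVING`, `SELECT` (numbered
`0, …, 4`). In the last two, aggregate functions range over the interpretations in `ctx`, the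
models of the inference rules used for them. -/
def GroupedQuery.Viable (ctx : Set AggInterp) (Qs T Q : GroupedQuery S A) (i : Fin 5) : Prop :=
  match i with
  | 0 => Q.frm.tables = Qs.frm.tables
  | 1 => ∀ ρ, RowHolds ρ Q.cond ↔ RowHolds ρ T.cond
  | 2 => ∀ ρ₁ ρ₂, RowHolds ρ₁ T.cond → RowHolds ρ₂ T.cond →
      (Q.keys.eval ρ₁ = Q.keys.eval ρ₂ ↔ T.keys.eval ρ₁ = T.keys.eval ρ₂)
  | 3 => ∀ I ∈ ctx, ∀ g, IsGroup Q.cond Q.keys g →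
      (GroupHolds I g Q.having ↔ GroupHolds I g T.having)
  | 4 => Q.distinct = T.distinct ∧ Q.select.length = T.select.length ∧
      ∀ I ∈ ctx, ∀ g, IsGroup Q.cond Q.keys g → Q.select.eval I g = T.select.eval I g

/-- Syntactic identity except in the fragments that the stages after the first `k` focus on. -/
def FlatQuery.Consistent (k : ℕ) (Q Q' : FlatQuery S A) : Prop :=
  (0 < k → Q.frm = Q'.frm) ∧ (1 < k → Q.cond = Q'.cond) ∧
  (2 < k → Q.distinct = Q'.distinct ∧ Q.select = Q'.select)

/-- Syntactic identity except in the fragments that the stages after the first `k` focus on. -/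
def GroupedQuery.Consistent (k : ℕ) (Q Q' : GroupedQuery S A) : Prop :=
  (0 < k → Q.frm = Q'.frm) ∧ (1 < k → Q.cond = Q'.cond) ∧ (2 < k → Q.keys = Q'.keys) ∧
  (3 < k → Q.having = Q'.having) ∧ (4 < k → Q.distinct = Q'.distinct ∧ Q.select = Q'.select)

/-! ## Repairing a condition (`WHERE` and `HAVING` stages) -/

/-- A position in a syntax tree: the list of child indices on the way from the root. -/
abbrev Path : Type := List ℕ

def Fml.IsNode : Fml α → Path → Prop
  | _, [] => True
  | .not f, i :: p => i = 0 ∧ f.IsNode p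
  | .node _ n c, i :: p => ∃ h : i < n, (c ⟨i, h⟩).IsNode p
  | _, _ :: _ => False

/-- The subtree at a position. -/
def Fml.subtree : Fml α → Path → Fml α
  | f, [] => f
  | .not f, _ :: p => f.subtree p
  | .node _ n c, i :: p => if h : i < n then (c ⟨i, h⟩).subtree p else .tru
  | _, _ :: _ => .tru

/-- The sites that lie below the child with index `i`, relative to that child. -/
def below (s : Finset Path) (i : ℕ) : Finset Path :=
  s.preimage (List.cons i) (List.cons_injective.injOn)

/-- A set of disjoint subtrees of `P`. -/
def IsSites (P : Fml α) (s : Finset Path) : Prop :=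
  (∀ p ∈ s, P.IsNode p) ∧ ∀ p ∈ s, ∀ q ∈ s, p <+: q → p = q

/-- Replacing the subtree at each site by its fix. -/
def Fml.repair : Fml α → Finset Path → (Path → Fml α) → Fml α
  | .tru, s, F => if [] ∈ s then F [] else .tru
  | .fls, s, F => if [] ∈ s then F [] else .fls
  | .atom a, s, F => if [] ∈ s then F [] else .atom a
  | .not f, s, F =>
      if [] ∈ s then F [] else .not (f.repair (below s 0) fun p => F (0 :: p))
  | .node op n c, s, F =>
      if [] ∈ s then F []
      else .node op n fun i => (c i).repair (below s i) fun p => F (i.val :: p)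

/-- Repair bounds: a lower and an upper bound for the formulas achievable by fixing the sites. -/
def Fml.createBounds : Fml α → Finset Path → Fml α × Fml α
  | .tru, s => if [] ∈ s then (.fls, .tru) else (.tru, .tru)
  | .fls, s => if [] ∈ s then (.fls, .tru) else (.fls, .fls)
  | .atom a, s => if [] ∈ s then (.fls, .tru) else (.atom a, .atom a)
  | .not f, s =>
      if [] ∈ s then (.fls, .tru)
      else (.not (f.createBounds (below s 0)).2, .not (f.createBounds (below s 0)).1)
  | .node op n c, s =>
      if [] ∈ s then (.fls, .tru)
      else (.node op n fun i => ((c i).createBounds (below s i)).1,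
        .node op n fun i => ((c i).createBounds (below s i)).2)

/-- The external components and the settings of the procedure that repairs a condition:
* `unsat` is the solver, `unsat φ = true` means that it reports `φ` to be unsatisfiable, and
  `false` stands for satisfiable or unknown;
* `minBool k g` minimizes a partial Boolean function `g` of `k` variables (`none` is a don't-care);
* `assign` says to which of the repaired children `R` of a node with operator `op` and children `c`
  each clause of their joint fix is given;
* `enum P k` lists the sets of at most `k` disjoint subtrees of `P`;
* `weight` is the weight of the number of sites in the cost, `cap` bounds that number. -/
structure Repairer (α : Type) where
  unsat : Fml α → Bool
  minBool : (k : ℕ) → ((Fin k → Bool) → Option Bool) → Fml (Fin k)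
  assign : (op : Conn) → (n : ℕ) → (c : Fin n → Fml α) → (R : Finset (Fin n)) → R.Nonempty →
    (clauses : List (Fml α)) → Fin clauses.length → {i : Fin n // i ∈ R}
  enum : Fml α → ℕ → List (Finset Path)
  weight : ℝ
  cap : ℕ

namespace Repairer

/-- The solver's answers "unsatisfiable" are right in every model in `M`, the minimizer returns a
Boolean expression with the prescribed values, and the enumeration is complete and goes by
ascending number of sites. -/
def Sound (r : Repairer α) (M : Set (α → Prop)) : Prop :=
  (∀ φ, r.unsat φ = true → ∀ v ∈ M, ¬ φ.Eval v) ∧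
  (∀ k g x b, g x = some b → ((r.minBool k g).Eval (fun i => x i = true) ↔ b = true)) ∧
  (∀ P k, (∀ s, s ∈ r.enum P k ↔ IsSites P s ∧ s.card ≤ k) ∧
    (r.enum P k).Pairwise fun s t => s.card ≤ t.card) ∧
  0 < r.weight ∧ 1 ≤ r.cap

variable (r : Repairer α)

/-- `p ⇒ q` is established (`FALSE ⇒ q` and `p ⇒ TRUE` need no solver). -/
def Implies (p q : Fml α) : Prop :=
  p = .fls ∨ q = .tru ∨ r.unsat (p.conj q.not) = true

/-- `p ⇔ q` is established. -/
def IsEquiv (p q : Fml α) : Prop := r.Implies p q ∧ r.Implies q p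

/-- Whether the atomic predicate `t` can be expressed by `a`: `some true` if they are equivalent,
`some false` if `t` is equivalent to the negation of `a`. -/
def expressedBy (t a : α) : Option Bool :=
  if t = a ∨ r.IsEquiv (.atom t) (.atom a) then some true
  else if r.IsEquiv (.atom t) (.not (.atom a)) then some false
  else none

/-- The chosen atomic predicates: one that is expressed by an earlier chosen one is dropped. -/
def chosen (l : List α) : List α :=
  l.foldl (fun as t => if ∃ a ∈ as, r.expressedBy t a ≠ none then as else as ++ [t]) []

/-- The literal over the Boolean variables of the chosen atomic predicates that stands for `t`. -/
def literal (as : List α) (t : α) : Fml (Fin as.length) :=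
  match (List.finRange as.length).find? fun i => (r.expressedBy t (as.get i)).isSome with
  | some i => if r.expressedBy t (as.get i) = some true then .atom i else .not (.atom i)
  | none => .tru

/-- The partial Boolean function of the chosen atomic predicates that lies between the Boolean
functions `l` and `u`. -/
def truthTable (as : List α) (l u : Fml (Fin as.length)) (x : Fin as.length → Bool) :
    Option Bool :=
  let row : Fml α := .node .and as.length fun i =>
    if x i then .atom (as.get i) else .not (.atom (as.get i))
  if r.unsat row = true then none
  else if (l.Eval fun i => x i = true) ↔ (u.Eval fun i => x i = true) then
    some (decide (l.Eval fun i => x i = true))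
  else none

/-- A small formula within the target bound `[l, u]`. -/
def minFix (l u : Fml α) : Fml α :=
  let as := r.chosen (l.atoms ++ u.atoms)
  (r.minBool as.length (r.truthTable as (l.bind (r.literal as)) (u.bind (r.literal as)))).map as.get

/-- The target bound pushed down to a child with repair bound `[lc, uc]` of a node with target
bound `[l, u]`; `[l', u']` is the combined repair bound of the other children. -/
def pushDown (op : Conn) (l u lc uc l' u' : Fml α) : Fml α × Fml α :=
  match op with
  | .and => (l, uc.conj (u.disj u'.not))
  | .or => (lc.disj (l.conj l'.not), u)

/-- The clauses of a formula seen as a conjunction or a disjunction. -/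
def clauses (op : Conn) : Fml α → List (Fml α)
  | .node op' n c => if op' = op then List.ofFn c else [.node op' n c]
  | f => [f]

/-- The part of the joint fix `f` of the repaired children `R` that goes to the child `i`. -/
def distributeFixes (op : Conn) {n : ℕ} (c : Fin n → Fml α) (R : Finset (Fin n))
    (hR : R.Nonempty) (f : Fml α) (i : Fin n) : Fml α :=
  let cs := clauses op f
  .big op (((List.finRange cs.length).filter fun k =>
    (r.assign op n c R hR cs k : Fin n) = i).map cs.get)

/-- The fixes for the sites `s` of a formula, given a target bound `[l, u]` for the formula. The
children that are themselves sites are treated as one child with repair bound `[FALSE, TRUE]`. -/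
def deriveFixes : Fml α → Finset Path → Fml α → Fml α → Path → Fml α
  | .tru, _, l, u, _ => r.minFix l u
  | .fls, _, l, u, _ => r.minFix l u
  | .atom _, _, l, u, _ => r.minFix l u
  | .not f, s, l, u, p =>
      if [] ∈ s then r.minFix l u
      else match p with
        | [] => .tru
        | _ :: q => deriveFixes f (below s 0) (.not u) (.not l) q
  | .node op n c, s, l, u, p =>
      if [] ∈ s then r.minFix l u
      else match p with
        | [] => .tru
        | i :: q =>
          if h : i < n then
            let R : Finset (Fin n) := Finset.univ.filter fun j => [j.val] ∈ s
            let bd : Fin n → Fml α × Fml α := fun j => (c j).createBounds (below s j)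
            let rest : List (Fin n) := (List.finRange n).filter fun j => j ∉ R
            if hi : (⟨i, h⟩ : Fin n) ∈ R then
              let t := pushDown op l u .fls .tru
                (.big op (rest.map fun j => (bd j).1)) (.big op (rest.map fun j => (bd j).2))
              r.distributeFixes op c R ⟨_, hi⟩ (r.minFix t.1 t.2) ⟨i, h⟩
            else
              let others := rest.filter fun j => j ≠ ⟨i, h⟩
              let t := pushDown op l u (bd ⟨i, h⟩).1 (bd ⟨i, h⟩).2
                (.big op ((others.map fun j => (bd j).1) ++ if R.Nonempty then [.fls] else []))
                (.big op ((others.map fun j => (bd j).2) ++ if R.Nonempty then [.tru] else []))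
              deriveFixes (c ⟨i, h⟩) (below s i) t.1 t.2 q
          else .tru

/-- The cost of a repair. -/
def cost (P Ps : Fml α) (s : Finset Path) (F : Path → Fml α) : ℝ :=
  r.weight * s.card +
    ∑ p ∈ s, (((P.subtree p).size + (F p).size : ℕ) : ℝ) / ((P.size + Ps.size : ℕ) : ℝ)

/-- The search through candidate sets of sites; `best` is the least cost found so far (initially
infinite) with a repair of that cost. -/
def search (P Ps : Fml α) : List (Finset Path) → WithTop ℝ × Finset Path × (Path → Fml α) →
    Finset Path × (Path → Fml α)
  | [], best => best.2
  | s :: L, best =>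
      if best.1 ≤ ((r.weight * s.card : ℝ) : WithTop ℝ) then best.2
      else if r.Implies (P.createBounds s).1 Ps ∧ r.Implies Ps (P.createBounds s).2 then
        let F := r.deriveFixes P s Ps Ps
        if ((r.cost P Ps s F : ℝ) : WithTop ℝ) < best.1 then
          search P Ps L ((r.cost P Ps s F : ℝ), s, F)
        else search P Ps L best
      else search P Ps L best

/-- The repair (sites and fixes) that is found for the condition `P` and the target `Ps`. -/
def repairCondition (P Ps : Fml α) : Finset Path × (Path → Fml α) :=
  r.search P Ps (r.enum P r.cap) (⊤, ∅, fun _ => .tru)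

/-- The result of applying that repair. -/
def repaired (P Ps : Fml α) : Fml α :=
  P.repair (r.repairCondition P Ps).1 (r.repairCondition P Ps).2

end Repairer

/-! ## The hints -/

/-- The hinting system: procedures for repairing `WHERE` conditions and, in a context given by a
`WHERE` condition and a `GROUP BY` list, `HAVING` conditions, and a solver for formulas about two
tuples. -/
structure QrHint (S : Schema) (A : Type) where
  row : Repairer (RAtom S A)
  group : Fml (RAtom S A) → Exprs S A → Repairer (GAtom S A)
  pairUnsat : Fml (RAtom S (A ⊕ A)) → Bool

/-- The models of a `WHERE` condition: all tuples. -/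
def rowModels (S : Schema) (A : Type) : Set (RAtom S A → Prop) :=
  {v | ∃ ρ : Env S A, v = fun a => a.Holds fun _ e => e.eval ρ}

/-- The models of a `HAVING` condition in the context of a `WHERE` condition and a `GROUP BY`
list: all groups, with aggregate functions interpreted as `ctx` allows. -/
def groupModels (ctx : Set AggInterp) (P : Fml (RAtom S A)) (o : Exprs S A) :
    Set (GAtom S A → Prop) :=
  {v | ∃ I ∈ ctx, ∃ g : Multiset (Env S A), IsGroup P o g ∧
    v = fun a => a.Holds fun _ e => e.eval I g}

namespace QrHint

/-- The external components are sound (no completeness is required). -/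
def Sound (ctx : Set AggInterp) (q : QrHint S A) : Prop :=
  q.row.Sound (rowModels S A) ∧
  (∀ P o, (q.group P o).Sound (groupModels ctx P o)) ∧
  ∀ φ, q.pairUnsat φ = true → ∀ ρ, ¬ RowHolds ρ φ

/-- The formula `e[t₁] op e[t₂]` about two tuples `t₁, t₂`. -/
def twoTuples (op : CmpOp) (e : Σ τ : Ty, Expr S A τ) : Fml (RAtom S (A ⊕ A)) :=
  .atom (.cmp op (e.2.rename Sum.inl) (e.2.rename Sum.inr))

/-- The solver cannot exclude two tuples that satisfy `P`, agree on the expressions `o` and differ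
on `e`. -/
def CanSplit (q : QrHint S A) (P : Fml (RAtom S A)) (o : Exprs S A) (e : Σ τ : Ty, Expr S A τ) :
    Prop :=
  q.pairUnsat (.big .and ([P.map (Atom.map fun _ e => e.rename Sum.inl),
    P.map (Atom.map fun _ e => e.rename Sum.inr),
    .big .and (o.map (twoTuples .eq)), twoTuples .ne e])) ≠ true

/-- The target expressions `es` that are missing from the current `GROUP BY` list, which grows as
missing expressions are found. -/
def missingKeys (q : QrHint S A) (P : Fml (RAtom S A)) : Exprs S A → Exprs S A → Exprs S A
  | _, [] => []
  | cur, e :: es =>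
      if q.CanSplit P cur e then e :: missingKeys q P (cur ++ [e]) es else missingKeys q P cur es

/-- The `GROUP BY` list `o` without its wrong expressions and with the missing ones among the
target expressions `os`. -/
def fixGrouping (q : QrHint S A) (P : Fml (RAtom S A)) (o os : Exprs S A) : Exprs S A :=
  let kept := o.filter fun e => ¬ q.CanSplit P os e
  kept ++ q.missingKeys P kept os

/-- Replacing the wrong expressions of a `SELECT` list by those of the target at the same position,
dropping excess ones and adding missing ones; `same` says that two expressions are established to
be equivalent. -/
def fixSelect {E : Type} (same : E → E → Prop) : List E → List E → List E
  | _, [] => []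
  | [], es => es
  | e :: l, e' :: l' => (if same e e' then e else e') :: fixSelect same l l'

/-- The solver establishes that two expressions are equal under the `WHERE` condition `P`. -/
def SameOnRows (q : QrHint S A) (P : Fml (RAtom S A)) (e e' : Σ τ : Ty, Expr S A τ) : Prop :=
  ∃ (τ : Ty) (x x' : Expr S A τ), e = ⟨τ, x⟩ ∧ e' = ⟨τ, x'⟩ ∧
    q.row.unsat (P.conj (.atom (.cmp .ne x x'))) = true

/-- The solver establishes that two expressions are equal on all groups. -/
def SameOnGroups (q : QrHint S A) (P : Fml (RAtom S A)) (o : Exprs S A)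
    (e e' : Σ τ : Ty, GExpr S A τ) : Prop :=
  ∃ (τ : Ty) (x x' : GExpr S A τ), e = ⟨τ, x⟩ ∧ e' = ⟨τ, x'⟩ ∧
    (q.group P o).unsat (.atom (.cmp .ne x x')) = true

end QrHint

/-- Following the `FROM` hint: every table is used more often or less often as needed to make its
count equal to that in the target, and references are added or removed accordingly. -/
def From.FollowsHint (Fs F F' : From S A) : Prop :=
  ∀ T, F'.tables.count T = Fs.tables.count T ∧
    (F.tables.count T ≤ Fs.tables.count T → ∀ a, (a, T) ∈ F → (a, T) ∈ F') ∧
    (Fs.tables.count T ≤ F.tables.count T → ∀ a, (a, T) ∈ F' → (a, T) ∈ F)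

/-- `Q'` follows the hint that is given in stage `i` for the working query `Q`. -/
def FlatQuery.FollowsHint (q : QrHint S A) (Qs T Q Q' : FlatQuery S A) (i : Fin 3) : Prop :=
  match i with
  | 0 => Qs.frm.FollowsHint Q.frm Q'.frm
  | 1 => Q'.cond = q.row.repaired Q.cond T.cond
  | 2 => Q'.distinct = T.distinct ∧
      Q'.select = QrHint.fixSelect (q.SameOnRows Q.cond) Q.select T.select

/-- `Q'` follows the hint that is given in stage `i` for the working query `Q`. -/
def GroupedQuery.FollowsHint (q : QrHint S A) (Qs T Q Q' : GroupedQuery S A) (i : Fin 5) : Prop :=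
  match i with
  | 0 => Qs.frm.FollowsHint Q.frm Q'.frm
  | 1 => Q'.cond = q.row.repaired Q.cond T.cond
  | 2 => Q'.keys = q.fixGrouping T.cond Q.keys T.keys
  | 3 => Q'.having = (q.group Q.cond Q.keys).repaired Q.having T.having
  | 4 => Q'.distinct = T.distinct ∧
      Q'.select = QrHint.fixSelect (q.SameOnGroups Q.cond Q.keys) Q.select T.select

end SQL

end

/-!
The theorem rests on three facts, one for each kind of work that a hint or a later stage does.

*Repairs are correct.* Fix a model of the condition, and give every node of the syntax tree the
truth values of its repair bounds `lc`, `uc` and of its target bounds `l`, `u` there. The naive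
invariant "the repaired node lies in `[l, u]`" fails below a conjunction or a disjunction, because
the target bound that is pushed down to a child need not be an interval and need not meet the
child's repair bounds. What does hold (`Repairer.Achieves`) is that the repaired node lies in
`[lc, uc]`, and in `[l, u]` wherever the repair bounds leave its value open and `l` implies `u`. A
conjunction inherits this from its children (`Achieves.forall`), a disjunction by duality, and at a
site it is the correctness of `minFix`: sound literals express all atoms by the chosen ones, and the
row of the truth table that the model induces cannot be reported unsatisfiable. At the root, where
`lc` implies the target and the target implies `uc`, the repaired condition is therefore equivalent
to the target (`Sound.eval_repaired`). The search always succeeds, because replacing the whole tree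
is a candidate whose bounds `[FALSE, TRUE]` are established without the solver.

*Viability is equivalence, clause by clause.* A table mapping extends to a permutation of all
aliases (`IsTableMapping.exists_perm`), and renaming by an injection does not change results; for a
grouped query this needs well-formedness, since the renamed group may be read off at another
representative (`GroupedQuery.rename_equiv`). Legal moves between `WHERE` and `HAVING` do not change
results either (`MovesCondition.equiv`). Hence the unified target is equivalent to the target, and a
query that passes all checks is equivalent to the unified target (`equiv_of_viable`).

*Clauses can be exchanged.* As long as the `WHERE` conditions are equivalent and the `GROUP BY` lists
induce the same groups, the clauses of the target stay well-formed in the working query and vice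
versa (`valid_of_target`). So in each stage the hinted clause is put into the working query and the
later clauses are taken from the target. Only the `FROM` stage has no unified target yet: there the
hint asks for dropping surplus references and adding missing ones under fresh aliases.
-/

noncomputable section

open scoped Classical

namespace SQL

/-! ### Syntax trees of conditions -/

namespace Fml

variable {α β : Type} {v : α → Prop}

@[simp] theorem eval_conj (p q : Fml α) : (p.conj q).Eval v ↔ p.Eval v ∧ q.Eval v := by
  simp [conj, big, Eval, Fin.forall_fin_two]

@[simp] theorem eval_disj (p q : Fml α) : (p.disj q).Eval v ↔ p.Eval v ∨ q.Eval v := by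
  simp [disj, big, Eval, Fin.exists_fin_two]

@[simp] theorem eval_big_and (l : List (Fml α)) :
    (big .and l).Eval v ↔ ∀ f ∈ l, f.Eval v := by
  simp [big, Eval, List.forall_mem_iff_get]

@[simp] theorem eval_big_or (l : List (Fml α)) :
    (big .or l).Eval v ↔ ∃ f ∈ l, f.Eval v := by
  simp [big, Eval, List.exists_mem_iff_get]

theorem eval_bind (s : α → Fml β) (w : β → Prop) (f : Fml α) :
    (f.bind s).Eval w ↔ f.Eval fun a => (s a).Eval w := by
  induction f with
  | tru => rfl
  | fls => rfl
  | atom a => rfl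
  | not f ih => simp [bind, Eval, ih]
  | node op n c ih => cases op <;> simp [bind, Eval, ih]

theorem eval_map (s : α → β) (w : β → Prop) (f : Fml α) :
    (f.map s).Eval w ↔ f.Eval fun a => w (s a) :=
  eval_bind _ _ _

theorem eval_congr {w : α → Prop} (f : Fml α) (h : ∀ a ∈ f.atoms, v a ↔ w a) :
    f.Eval v ↔ f.Eval w := by
  induction f with
  | tru => rfl
  | fls => rfl
  | atom a => exact h a (by simp [atoms])
  | not f ih => exact not_congr (ih h)
  | node op n c ih =>
    have ih' : ∀ i, (c i).Eval v ↔ (c i).Eval w := fun i =>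
      ih i fun a ha => h a (by simpa [atoms] using ⟨i, ha⟩)
    cases op <;> simp [Eval, ih']

@[simp] theorem mem_atoms_node {op : Conn} {n : ℕ} {c : Fin n → Fml α} {a : α} :
    a ∈ (node op n c).atoms ↔ ∃ i, a ∈ (c i).atoms := by
  simp [atoms]

@[simp] theorem mem_atoms_big {op : Conn} {l : List (Fml α)} {a : α} :
    a ∈ (big op l).atoms ↔ ∃ f ∈ l, a ∈ f.atoms := by
  simp [big, List.exists_mem_iff_get]

theorem mem_atoms_bind {s : α → Fml β} {b : β} (f : Fml α) :
    b ∈ (f.bind s).atoms ↔ ∃ a ∈ f.atoms, b ∈ (s a).atoms := by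
  induction f with
  | tru => simp [bind, atoms]
  | fls => simp [bind, atoms]
  | atom a => simp [bind, atoms]
  | not f ih => exact ih
  | node op n c ih =>
    simp only [bind, mem_atoms_node, ih]
    exact ⟨fun ⟨i, a, h, h'⟩ => ⟨a, ⟨i, h⟩, h'⟩, fun ⟨a, ⟨i, h⟩, h'⟩ => ⟨i, a, h, h'⟩⟩

theorem mem_atoms_map {s : α → β} {b : β} {f : Fml α} :
    b ∈ (f.map s).atoms ↔ ∃ a ∈ f.atoms, s a = b := by
  simp [map, mem_atoms_bind, atoms, eq_comm]

theorem map_congr {s t : α → β} (f : Fml α) (h : ∀ a ∈ f.atoms, s a = t a) :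
    f.map s = f.map t := by
  induction f with
  | tru => rfl
  | fls => rfl
  | atom a => simp [map, bind, h a (by simp [atoms])]
  | not f ih => exact congrArg Fml.not (ih h)
  | node op n c ih =>
    refine congrArg (Fml.node op n) (funext fun i => ih i fun a ha => h a ?_)
    simpa using ⟨i, ha⟩

theorem repair_root (f : Fml α) {s : Finset Path} (F : Path → Fml α) (hs : [] ∈ s) :
    f.repair s F = F [] := by
  cases f <;> simp [repair, hs]

theorem createBounds_root (f : Fml α) {s : Finset Path} (hs : [] ∈ s) :
    f.createBounds s = (.fls, .tru) := by
  cases f <;> simp [createBounds, hs]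

theorem createBounds_atoms (f : Fml α) (s : Finset Path) (a : α)
    (ha : a ∈ (f.createBounds s).1.atoms ∨ a ∈ (f.createBounds s).2.atoms) : a ∈ f.atoms := by
  induction f generalizing s with
  | tru => by_cases hs : [] ∈ s <;> simp_all [createBounds, atoms]
  | fls => by_cases hs : [] ∈ s <;> simp_all [createBounds, atoms]
  | atom a => by_cases hs : [] ∈ s <;> simp_all [createBounds, atoms]
  | not f ih =>
    by_cases hs : [] ∈ s
    · simp [createBounds, hs, atoms] at ha
    · simp only [createBounds, hs, if_false, atoms] at ha ⊢
      exact ih _ ha.symm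
  | node op n c ih =>
    by_cases hs : [] ∈ s
    · simp [createBounds, hs, atoms] at ha
    · simp only [createBounds, hs, if_false, mem_atoms_node] at ha ⊢
      rcases ha with ⟨i, ha⟩ | ⟨i, ha⟩
      · exact ⟨i, ih i _ (.inl ha)⟩
      · exact ⟨i, ih i _ (.inr ha)⟩

end Fml

theorem nil_mem_below {s : Finset Path} {i : ℕ} : [] ∈ below s i ↔ [i] ∈ s := by
  simp [below]

/-! ### Small formulas within a target bound -/

namespace Repairer

variable {α : Type} (r : Repairer α) {v : α → Prop}

/-- The part of `Repairer.Sound` that concerns a single model `v`. -/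
def SoundAt (v : α → Prop) : Prop :=
  (∀ φ, r.unsat φ = true → ¬ φ.Eval v) ∧
  ∀ k g x b, g x = some b → ((r.minBool k g).Eval (fun i => x i = true) ↔ b = true)

variable {r}

theorem Sound.soundAt {M : Set (α → Prop)} (h : r.Sound M) (hv : v ∈ M) : r.SoundAt v :=
  ⟨fun φ hφ => h.1 φ hφ v hv, h.2.1⟩

theorem SoundAt.implies (h : r.SoundAt v) {p q : Fml α} (hpq : r.Implies p q) (hp : p.Eval v) :
    q.Eval v := by
  rcases hpq with rfl | rfl | hu
  · exact hp.elim
  · trivial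
  · by_contra hq
    exact h.1 _ hu (by simp [Fml.Eval, hp, hq])

theorem SoundAt.eval_iff (h : r.SoundAt v) {p q : Fml α} (hpq : r.IsEquiv p q) :
    p.Eval v ↔ q.Eval v :=
  ⟨h.implies hpq.1, h.implies hpq.2⟩

theorem SoundAt.expressedBy_true (h : r.SoundAt v) {t a : α}
    (hta : r.expressedBy t a = some true) : v t ↔ v a := by
  unfold expressedBy at hta
  split_ifs at hta with h₁ h₂
  · rcases h₁ with rfl | h₁
    · rfl
    · exact h.eval_iff h₁
  · simp at hta

theorem SoundAt.expressedBy_false (h : r.SoundAt v) {t a : α}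
    (hta : r.expressedBy t a = some false) : v t ↔ ¬ v a := by
  unfold expressedBy at hta
  split_ifs at hta with h₁ h₂
  · simp at hta
  · exact h.eval_iff h₂

theorem expressedBy_self (a : α) : r.expressedBy a a = some true := by
  simp [expressedBy]

/-- Atoms are only ever added to the chosen ones, and an atom that is not added is expressed by a
chosen one. -/
theorem foldl_chosen_spec (l as : List α) :
    let bs := l.foldl
      (fun as t => if ∃ a ∈ as, r.expressedBy t a ≠ none then as else as ++ [t]) as
    (∀ a ∈ as, a ∈ bs) ∧ (∀ b ∈ bs, b ∈ as ∨ b ∈ l) ∧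
      ∀ t ∈ l, ∃ b ∈ bs, r.expressedBy t b ≠ none := by
  induction l generalizing as with
  | nil => simp
  | cons t l ih =>
    simp only [List.foldl_cons]
    split_ifs with h
    · obtain ⟨h₁, h₂, h₃⟩ := ih as
      refine ⟨h₁, fun b hb => (h₂ b hb).imp_right (List.mem_cons_of_mem _), ?_⟩
      intro t' ht'
      rcases List.mem_cons.1 ht' with rfl | ht'
      · obtain ⟨a, ha, hta⟩ := h
        exact ⟨a, h₁ a ha, hta⟩
      · exact h₃ t' ht'
    · obtain ⟨h₁, h₂, h₃⟩ := ih (as ++ [t])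
      refine ⟨fun a ha => h₁ a (by simp [ha]), fun b hb => ?_, ?_⟩
      · rcases h₂ b hb with hb | hb
        · simp only [List.mem_append, List.mem_singleton] at hb
          rcases hb with hb | rfl
          · exact .inl hb
          · exact .inr (by simp)
        · exact .inr (by simp [hb])
      · intro t' ht'
        rcases List.mem_cons.1 ht' with rfl | ht'
        · exact ⟨t', h₁ t' (by simp), by simp [expressedBy_self]⟩
        · exact h₃ t' ht'

theorem mem_of_mem_chosen {l : List α} {a : α} (ha : a ∈ r.chosen l) : a ∈ l := by
  simpa using (foldl_chosen_spec (r := r) l []).2.1 a ha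

theorem exists_chosen {l : List α} {t : α} (ht : t ∈ l) :
    ∃ a ∈ r.chosen l, r.expressedBy t a ≠ none :=
  (foldl_chosen_spec (r := r) l []).2.2 t ht

theorem SoundAt.eval_literal (h : r.SoundAt v) {as : List α} {t : α}
    (ht : ∃ a ∈ as, r.expressedBy t a ≠ none) :
    (r.literal as t).Eval (fun i => v (as.get i)) ↔ v t := by
  unfold literal
  split
  · next i hi =>
    have hi := List.find?_some hi
    obtain ⟨b, hb⟩ := Option.isSome_iff_exists.1 hi
    cases b with
    | true => simp only [hb, if_true]; exact (h.expressedBy_true hb).symm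
    | false => simp only [hb]; exact (h.expressedBy_false hb).symm
  · next hi =>
    obtain ⟨a, ha, hta⟩ := ht
    obtain ⟨i, rfl⟩ := List.get_of_mem ha
    have := List.find?_eq_none.1 hi i (List.mem_finRange i)
    exact absurd (Option.not_isSome_iff_eq_none.1 this) hta

/-- A minimized formula lies within its target bound in every model in which that bound is an
interval at all. -/
theorem SoundAt.minFix (h : r.SoundAt v) {l u : Fml α} (hlu : l.Eval v → u.Eval v) :
    (l.Eval v → (r.minFix l u).Eval v) ∧ ((r.minFix l u).Eval v → u.Eval v) := by
  set as := r.chosen (l.atoms ++ u.atoms) with has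
  -- The truth assignment of the chosen atoms that the model induces.
  let x : Fin as.length → Bool := fun i => decide (v (as.get i))
  have hx : (fun i => x i = true) = fun i => v (as.get i) := by simp [x]
  have hlit : ∀ f : Fml α, (∀ t ∈ f.atoms, t ∈ l.atoms ++ u.atoms) →
      ((f.bind (r.literal as)).Eval (fun i => x i = true) ↔ f.Eval v) := by
    intro f hf
    rw [Fml.eval_bind, hx]
    exact Fml.eval_congr f fun t ht => h.eval_literal (exists_chosen (hf t ht))
  have hl := hlit l fun t ht => by simp [ht]
  have hu := hlit u fun t ht => by simp [ht]
  by_cases heq : l.Eval v ↔ u.Eval v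
  · have htab : r.truthTable as (l.bind (r.literal as)) (u.bind (r.literal as)) x =
        some (decide (l.Eval v)) := by
      have hrow : r.unsat (.node .and as.length fun i =>
          if x i then .atom (as.get i) else .not (.atom (as.get i))) ≠ true := by
        intro hun
        refine h.1 _ hun fun i => ?_
        by_cases hi : v as[i.val] <;> simp [x, Fml.Eval, hi]
      unfold truthTable
      simp only [hrow, hl, hu, heq]
      simp
    have hmin := h.2 _ _ _ _ htab
    have hfix : (r.minFix l u).Eval v ↔ l.Eval v := by
      rw [Repairer.minFix, Fml.eval_map, ← has, ← hx, hmin]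
      simp
    exact ⟨hfix.2, fun hf => heq.1 (hfix.1 hf)⟩
  · have hl' : ¬ l.Eval v := fun hl => heq ⟨hlu, fun _ => hl⟩
    have hu' : u.Eval v := by
      by_contra hu
      exact heq ⟨fun h => absurd h hl', fun h => absurd h hu⟩
    exact ⟨fun h => absurd h hl', fun _ => hu'⟩

theorem minFix_atoms {l u : Fml α} {a : α} (ha : a ∈ (r.minFix l u).atoms) :
    a ∈ l.atoms ∨ a ∈ u.atoms := by
  rw [Repairer.minFix, Fml.mem_atoms_map] at ha
  obtain ⟨i, -, rfl⟩ := ha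
  simpa using mem_of_mem_chosen (List.get_mem _ i)

/-! ### Distributing a joint fix among children -/

theorem forall_clauses_and (f : Fml α) : (∀ g ∈ clauses .and f, g.Eval v) ↔ f.Eval v := by
  cases f with
  | node op n c => cases op <;> simp [clauses, Fml.Eval]
  | _ => simp [clauses]

theorem exists_clauses_or (f : Fml α) : (∃ g ∈ clauses .or f, g.Eval v) ↔ f.Eval v := by
  cases f with
  | node op n c => cases op <;> simp [clauses, Fml.Eval, List.mem_ofFn]
  | _ => simp [clauses]

theorem clauses_atoms {op : Conn} {f g : Fml α} (hg : g ∈ clauses op f) {a : α}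
    (ha : a ∈ g.atoms) : a ∈ f.atoms := by
  cases f with
  | node op' n c =>
    by_cases h : op' = op
    · simp only [clauses, h, if_true, List.mem_ofFn] at hg
      obtain ⟨i, rfl⟩ := hg
      exact Fml.mem_atoms_node.2 ⟨i, ha⟩
    · simp only [clauses, h, if_false, List.mem_singleton] at hg
      exact hg ▸ ha
  | _ => simp only [clauses, List.mem_singleton] at hg; exact hg ▸ ha

theorem forall_distributeFixes_and {n : ℕ} (c : Fin n → Fml α) (R : Finset (Fin n))
    (hR : R.Nonempty) (f : Fml α) :
    (∀ i ∈ R, (r.distributeFixes .and c R hR f i).Eval v) ↔ f.Eval v := by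
  rw [← forall_clauses_and (v := v) f]
  simp only [distributeFixes, Fml.eval_big_and, List.mem_map, List.mem_filter, List.mem_finRange,
    true_and, decide_eq_true_eq, forall_exists_index, and_imp, forall_apply_eq_imp_iff₂]
  constructor
  · intro h g hg
    obtain ⟨k, rfl⟩ := List.get_of_mem hg
    exact h _ (r.assign .and n c R hR (clauses .and f) k).2 k rfl
  · intro h i _ k _
    exact h _ (List.get_mem _ k)

theorem exists_distributeFixes_or {n : ℕ} (c : Fin n → Fml α) (R : Finset (Fin n))
    (hR : R.Nonempty) (f : Fml α) :
    (∃ i ∈ R, (r.distributeFixes .or c R hR f i).Eval v) ↔ f.Eval v := by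
  rw [← exists_clauses_or (v := v) f]
  simp only [distributeFixes, Fml.eval_big_or, List.mem_map, List.mem_filter, List.mem_finRange,
    true_and, decide_eq_true_eq]
  constructor
  · rintro ⟨i, _, _, ⟨k, _, rfl⟩, h⟩
    exact ⟨_, List.get_mem _ k, h⟩
  · rintro ⟨g, hg, h⟩
    obtain ⟨k, rfl⟩ := List.get_of_mem hg
    exact ⟨_, (r.assign .or n c R hR (clauses .or f) k).2, _, ⟨k, rfl, rfl⟩, h⟩

theorem distributeFixes_atoms {op : Conn} {n : ℕ} {c : Fin n → Fml α} {R : Finset (Fin n)}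
    {hR : R.Nonempty} {f : Fml α} {i : Fin n} {a : α}
    (ha : a ∈ (r.distributeFixes op c R hR f i).atoms) : a ∈ f.atoms := by
  simp only [distributeFixes, Fml.mem_atoms_big, List.mem_map] at ha
  obtain ⟨_, ⟨k, _, rfl⟩, ha⟩ := ha
  exact clauses_atoms (List.get_mem _ k) ha

/-! ### Correctness of the derived fixes -/

/-- The children of a node that are themselves sites. -/
def siteChildren (s : Finset Path) (n : ℕ) : Finset (Fin n) :=
  Finset.univ.filter fun j => [j.val] ∈ s

theorem mem_siteChildren {s : Finset Path} {n : ℕ} {i : Fin n} :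
    i ∈ siteChildren s n ↔ [i.val] ∈ s := by
  simp [siteChildren]

/-- The combined repair bound of the children in a list together with, if `b` holds, one more child
with the bound `[FALSE, TRUE]`. -/
def combinedBounds (op : Conn) {n : ℕ} (c : Fin n → Fml α) (s : Finset Path) (L : List (Fin n))
    (b : Prop) [Decidable b] : Fml α × Fml α :=
  (.big op ((L.map fun j => ((c j).createBounds (below s j)).1) ++ if b then [.fls] else []),
   .big op ((L.map fun j => ((c j).createBounds (below s j)).2) ++ if b then [.tru] else []))

/-- The children that are not sites themselves, without the child `i`. -/
def otherChildren (s : Finset Path) {n : ℕ} (i : Fin n) : List (Fin n) :=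
  ((List.finRange n).filter fun j => j ∉ siteChildren s n).filter fun j => j ≠ i

/-- The target bound of the joint fix of the children that are sites. -/
def jointTarget (op : Conn) {n : ℕ} (c : Fin n → Fml α) (s : Finset Path) (l u : Fml α) :
    Fml α × Fml α :=
  let b := combinedBounds op c s ((List.finRange n).filter fun j => j ∉ siteChildren s n) False
  pushDown op l u .fls .tru b.1 b.2

/-- The target bound of a child that is not a site itself. -/
def childTarget (op : Conn) {n : ℕ} (c : Fin n → Fml α) (s : Finset Path) (l u : Fml α)
    (i : Fin n) : Fml α × Fml α :=
  let b := combinedBounds op c s (otherChildren s i) (siteChildren s n).Nonempty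
  pushDown op l u ((c i).createBounds (below s i)).1 ((c i).createBounds (below s i)).2 b.1 b.2

theorem deriveFixes_root (f : Fml α) {s : Finset Path} (hs : [] ∈ s) (l u : Fml α) (p : Path) :
    r.deriveFixes f s l u p = r.minFix l u := by
  cases f with
  | tru => rfl
  | fls => rfl
  | atom a => rfl
  | not f => cases p <;> simp [deriveFixes, hs]
  | node op n c => cases p <;> simp [deriveFixes, hs]

theorem deriveFixes_site {op : Conn} {n : ℕ} (c : Fin n → Fml α) {s : Finset Path}
    (hs : [] ∉ s) (l u : Fml α) (i : Fin n) (hi : i ∈ siteChildren s n) (p : Path) :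
    r.deriveFixes (.node op n c) s l u (i.val :: p) =
      r.distributeFixes op c (siteChildren s n) ⟨i, hi⟩
        (r.minFix (jointTarget op c s l u).1 (jointTarget op c s l u).2) i := by
  have hi' : i ∈ Finset.univ.filter fun j : Fin n => [j.val] ∈ s := hi
  simp only [deriveFixes, hs, if_false, i.isLt, dite_true, Fin.eta, hi']
  simp [jointTarget, combinedBounds, siteChildren]

theorem deriveFixes_nonsite {op : Conn} {n : ℕ} (c : Fin n → Fml α) {s : Finset Path}
    (hs : [] ∉ s) (l u : Fml α) (i : Fin n) (hi : i ∉ siteChildren s n) (p : Path) :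
    r.deriveFixes (.node op n c) s l u (i.val :: p) =
      r.deriveFixes (c i) (below s i) (childTarget op c s l u i).1
        (childTarget op c s l u i).2 p := by
  have hi' : i ∉ Finset.univ.filter fun j : Fin n => [j.val] ∈ s := hi
  simp only [deriveFixes, hs, if_false, i.isLt, dite_true, Fin.eta, hi', dite_false]
  rfl

theorem combinedBounds_atoms {op : Conn} {n : ℕ} {c : Fin n → Fml α} {s : Finset Path}
    {L : List (Fin n)} {b : Prop} [Decidable b] {a : α}
    (ha : a ∈ (combinedBounds op c s L b).1.atoms ∨ a ∈ (combinedBounds op c s L b).2.atoms) :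
    a ∈ (Fml.node op n c).atoms := by
  rw [Fml.mem_atoms_node]
  by_cases hb : b <;>
  · simp only [combinedBounds, hb, Fml.mem_atoms_big, List.mem_append, List.mem_map] at ha
    rcases ha with ⟨f, hf, ha⟩ | ⟨f, hf, ha⟩
    · rcases hf with ⟨j, _, rfl⟩ | hf
      · exact ⟨j, Fml.createBounds_atoms _ _ _ (.inl ha)⟩
      · simp_all [Fml.atoms]
    · rcases hf with ⟨j, _, rfl⟩ | hf
      · exact ⟨j, Fml.createBounds_atoms _ _ _ (.inr ha)⟩
      · simp_all [Fml.atoms]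

theorem pushDown_atoms {op : Conn} {l u lc uc l' u' : Fml α} {X : Set α}
    (hl : ∀ a ∈ l.atoms, a ∈ X) (hu : ∀ a ∈ u.atoms, a ∈ X) (hlc : ∀ a ∈ lc.atoms, a ∈ X)
    (huc : ∀ a ∈ uc.atoms, a ∈ X) (hl' : ∀ a ∈ l'.atoms, a ∈ X) (hu' : ∀ a ∈ u'.atoms, a ∈ X) :
    (∀ a ∈ (pushDown op l u lc uc l' u').1.atoms, a ∈ X) ∧
      ∀ a ∈ (pushDown op l u lc uc l' u').2.atoms, a ∈ X := by
  cases op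
  · refine ⟨hl, fun a ha => ?_⟩
    simp only [pushDown, Fml.conj, Fml.disj, Fml.mem_atoms_big, List.mem_cons, List.not_mem_nil,
      or_false, exists_eq_or_imp, exists_eq_left, Fml.atoms] at ha
    rcases ha with ha | ha | ha
    exacts [huc a ha, hu a ha, hu' a ha]
  · refine ⟨fun a ha => ?_, hu⟩
    simp only [pushDown, Fml.conj, Fml.disj, Fml.mem_atoms_big, List.mem_cons, List.not_mem_nil,
      or_false, exists_eq_or_imp, exists_eq_left, Fml.atoms] at ha
    rcases ha with ha | ha | ha
    exacts [hlc a ha, hl a ha, hl' a ha]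

theorem deriveFixes_atoms (f : Fml α) (s : Finset Path) (l u : Fml α) (p : Path) {X : Set α}
    (hf : ∀ a ∈ f.atoms, a ∈ X) (hl : ∀ a ∈ l.atoms, a ∈ X) (hu : ∀ a ∈ u.atoms, a ∈ X) :
    ∀ a ∈ (r.deriveFixes f s l u p).atoms, a ∈ X := by
  have hmin : ∀ {l u : Fml α}, (∀ a ∈ l.atoms, a ∈ X) → (∀ a ∈ u.atoms, a ∈ X) →
      ∀ a ∈ (r.minFix l u).atoms, a ∈ X :=
    fun hl hu a ha => (minFix_atoms ha).elim (hl a) (hu a)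
  induction f generalizing s l u p with
  | tru => exact hmin hl hu
  | fls => exact hmin hl hu
  | atom a => exact hmin hl hu
  | not f ih =>
    by_cases hs : [] ∈ s
    · rw [deriveFixes_root _ hs]; exact hmin hl hu
    · cases p with
      | nil => simp [deriveFixes, hs, Fml.atoms]
      | cons i q =>
        simp only [deriveFixes, hs, if_false]
        exact ih _ _ _ _ hf hu hl
  | node op n c ih =>
    by_cases hs : [] ∈ s
    · rw [deriveFixes_root _ hs]; exact hmin hl hu
    · cases p with
      | nil => simp [deriveFixes, hs, Fml.atoms]
      | cons i q =>
        by_cases hin : i < n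
        · by_cases hi : (⟨i, hin⟩ : Fin n) ∈ siteChildren s n
          · have h := deriveFixes_site (r := r) (op := op) c hs l u ⟨i, hin⟩ hi q
            rw [show ((⟨i, hin⟩ : Fin n) : ℕ) = i from rfl] at h
            rw [h]
            intro a ha
            obtain ⟨h₁, h₂⟩ := pushDown_atoms (op := op) hl hu (lc := .fls) (uc := .tru)
              (by simp [Fml.atoms]) (by simp [Fml.atoms])
              (fun a ha => hf a (combinedBounds_atoms (b := False) (s := s) (.inl ha)))
              (fun a ha => hf a (combinedBounds_atoms (b := False) (s := s) (.inr ha)))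
            exact hmin h₁ h₂ a (distributeFixes_atoms ha)
          · have h := deriveFixes_nonsite (r := r) (op := op) c hs l u ⟨i, hin⟩ hi q
            rw [show ((⟨i, hin⟩ : Fin n) : ℕ) = i from rfl] at h
            rw [h]
            have hc : ∀ a ∈ (c ⟨i, hin⟩).atoms, a ∈ X :=
              fun a ha => hf a (Fml.mem_atoms_node.2 ⟨_, ha⟩)
            obtain ⟨h₁, h₂⟩ := pushDown_atoms (op := op) hl hu
              (fun a ha => hc a (Fml.createBounds_atoms _ _ _ (.inl ha)))
              (fun a ha => hc a (Fml.createBounds_atoms _ _ _ (.inr ha)))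
              (fun a ha => hf a (combinedBounds_atoms (b := (siteChildren s n).Nonempty) (s := s)
                (.inl ha)))
              (fun a ha => hf a (combinedBounds_atoms (b := (siteChildren s n).Nonempty) (s := s)
                (.inr ha)))
            exact ih _ _ _ _ _ hc h₁ h₂
        · simp [deriveFixes, hs, hin, Fml.atoms]

theorem repair_atoms (f : Fml α) (s : Finset Path) (F : Path → Fml α) {X : Set α}
    (hf : ∀ a ∈ f.atoms, a ∈ X) (hF : ∀ p, ∀ a ∈ (F p).atoms, a ∈ X) :
    ∀ a ∈ (f.repair s F).atoms, a ∈ X := by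
  induction f generalizing s F with
  | not f ih =>
    by_cases hs : [] ∈ s
    · rw [Fml.repair_root _ _ hs]; exact hF _
    · simp only [Fml.repair, hs, if_false]
      exact ih _ _ hf fun p => hF _
  | node op n c ih =>
    by_cases hs : [] ∈ s
    · rw [Fml.repair_root _ _ hs]; exact hF _
    · simp only [Fml.repair, hs, if_false, Fml.mem_atoms_node]
      rintro a ⟨i, ha⟩
      exact ih i _ _ (fun a ha => hf a (Fml.mem_atoms_node.2 ⟨i, ha⟩)) (fun p => hF _) a ha
  | _ =>
    by_cases hs : [] ∈ s
    · rw [Fml.repair_root _ _ hs]; exact hF _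
    · simpa only [Fml.repair, hs, if_false] using hf

theorem eval_jointTarget_and {n : ℕ} (c : Fin n → Fml α) (s : Finset Path) (l u : Fml α) :
    ((jointTarget .and c s l u).1.Eval v ↔ l.Eval v) ∧
    ((jointTarget .and c s l u).2.Eval v ↔ (u.Eval v ∨
      ∃ j ∉ siteChildren s n, ¬ ((c j).createBounds (below s j)).2.Eval v)) := by
  constructor
  · rfl
  · simp [jointTarget, pushDown, combinedBounds, Fml.Eval]

theorem eval_jointTarget_or {n : ℕ} (c : Fin n → Fml α) (s : Finset Path) (l u : Fml α) :
    ((jointTarget .or c s l u).1.Eval v ↔ (l.Eval v ∧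
      ∀ j ∉ siteChildren s n, ¬ ((c j).createBounds (below s j)).1.Eval v)) ∧
    ((jointTarget .or c s l u).2.Eval v ↔ u.Eval v) := by
  constructor
  · simp [jointTarget, pushDown, combinedBounds, Fml.Eval]
  · rfl

theorem eval_childTarget_and {n : ℕ} (c : Fin n → Fml α) (s : Finset Path) (l u : Fml α)
    (i : Fin n) :
    ((childTarget .and c s l u i).1.Eval v ↔ l.Eval v) ∧
    ((childTarget .and c s l u i).2.Eval v ↔ ((c i).createBounds (below s i)).2.Eval v ∧
      (u.Eval v ∨ ∃ j, j ≠ i ∧ j ∉ siteChildren s n ∧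
        ¬ ((c j).createBounds (below s j)).2.Eval v)) := by
  constructor
  · rfl
  · by_cases hR : (siteChildren s n).Nonempty <;>
      simp [childTarget, pushDown, combinedBounds, otherChildren, Fml.Eval, hR, and_assoc]

theorem eval_childTarget_or {n : ℕ} (c : Fin n → Fml α) (s : Finset Path) (l u : Fml α)
    (i : Fin n) :
    ((childTarget .or c s l u i).1.Eval v ↔ ((c i).createBounds (below s i)).1.Eval v ∨
      (l.Eval v ∧ ∀ j, j ≠ i → j ∉ siteChildren s n →
        ¬ ((c j).createBounds (below s j)).1.Eval v)) ∧
    ((childTarget .or c s l u i).2.Eval v ↔ u.Eval v) := by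
  constructor
  · by_cases hR : (siteChildren s n).Nonempty <;>
      simp [childTarget, pushDown, combinedBounds, otherChildren, Fml.Eval, hR, and_assoc]
  · rfl

/-- What the fixes achieve in a single model, where a node has repair bounds `lc`, `uc`, target
bounds `l`, `u`, and the value `g` after the repair: the value respects the repair bounds, and it
lies within the target bounds unless the repair bounds force it or `l`, `u` is no interval. -/
def Achieves (lc uc l u g : Prop) : Prop :=
  (lc → g) ∧ (g → uc) ∧ (¬ lc → uc → (l → u) → (l → g) ∧ (g → u))

theorem Achieves.not {lc uc l u g : Prop} (h : Achieves lc uc l u g) :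
    Achieves (¬ uc) (¬ lc) (¬ u) (¬ l) (¬ g) := by
  unfold Achieves at *
  tauto

/-- The heart of the correctness of the procedure. A child whose lower bound fails need not respect
the upper target bound `u` if some sibling's upper repair bound fails: then that sibling makes the
conjunction false anyway. -/
theorem Achieves.forall {ι : Type} {R : Set ι} {L U G : ι → Prop} {l u : Prop}
    (hchild : ∀ i ∉ R, Achieves (L i) (U i) l (U i ∧ (u ∨ ∃ j, j ≠ i ∧ j ∉ R ∧ ¬ U j)) (G i))
    (hL : ∀ i ∈ R, ¬ L i) (hU : ∀ i ∈ R, U i)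
    (hjoint : R.Nonempty → (l → u ∨ ∃ j, j ∉ R ∧ ¬ U j) →
      (l → ∀ i ∈ R, G i) ∧ ((∀ i ∈ R, G i) → u ∨ ∃ j, j ∉ R ∧ ¬ U j)) :
    Achieves (∀ i, L i) (∀ i, U i) l u (∀ i, G i) := by
  refine ⟨fun h i => ?_, fun h i => ?_, fun hnl hu hlu => ⟨fun hl i => ?_, fun hg => ?_⟩⟩
  · exact (hchild i fun hi => hL i hi (h i)).1 (h i)
  · by_cases hi : i ∈ R
    · exact hU i hi
    · exact (hchild i hi).2.1 (h i)
  · by_cases hi : i ∈ R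
    · exact (hjoint ⟨i, hi⟩ fun hl => .inl (hlu hl)).1 hl i hi
    · by_cases hLi : L i
      · exact (hchild i hi).1 hLi
      · exact ((hchild i hi).2.2 hLi (hu i) fun hl => ⟨hu i, .inl (hlu hl)⟩).1 hl
  · obtain ⟨i, hLi⟩ := not_forall.1 hnl
    by_cases hi : i ∈ R
    · rcases (hjoint ⟨i, hi⟩ fun hl => .inl (hlu hl)).2 fun j _ => hg j with h | ⟨j, _, hj⟩
      · exact h
      · exact absurd (hu j) hj
    · rcases (((hchild i hi).2.2 hLi (hu i) fun hl => ⟨hu i, .inl (hlu hl)⟩).2 (hg i)).2 with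
        h | ⟨j, _, _, hj⟩
      · exact h
      · exact absurd (hu j) hj

theorem Achieves.exists {ι : Type} {R : Set ι} {L U G : ι → Prop} {l u : Prop}
    (hchild : ∀ i ∉ R, Achieves (L i) (U i) (L i ∨ (l ∧ ∀ j, j ≠ i → j ∉ R → ¬ L j)) u (G i))
    (hL : ∀ i ∈ R, ¬ L i) (hU : ∀ i ∈ R, U i)
    (hjoint : R.Nonempty → ((l ∧ ∀ j, j ∉ R → ¬ L j) → u) →
      ((l ∧ ∀ j, j ∉ R → ¬ L j) → ∃ i ∈ R, G i) ∧ ((∃ i ∈ R, G i) → u)) :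
    Achieves (∃ i, L i) (∃ i, U i) l u (∃ i, G i) := by
  have h := Achieves.forall (R := R) (L := fun i => ¬ U i) (U := fun i => ¬ L i)
    (G := fun i => ¬ G i) (l := ¬ u) (u := ¬ l) ?_ (by simpa using hU) hL ?_
  · simpa using h.not
  · intro i hi
    have h := (hchild i hi).not
    simpa only [not_or, not_and_or, not_forall, not_not, exists_prop] using h
  · intro hR hul
    have h := hjoint hR fun ⟨hl, hLj⟩ => by
      by_contra hu
      rcases hul hu with h | ⟨j, hj, hj'⟩
      · exact h hl
      · exact hj' (hLj j hj)
    refine ⟨fun hu i hi hg => hu (h.2 ⟨i, hi, hg⟩), fun hg => ?_⟩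
    by_contra hcon
    simp only [not_or, not_exists, not_and, not_not] at hcon
    obtain ⟨i, hi, hgi⟩ := h.1 ⟨hcon.1, hcon.2⟩
    exact hg i hi hgi

theorem achieves_minFix (h : r.SoundAt v) (l u : Fml α) :
    Achieves False True (l.Eval v) (u.Eval v) ((r.minFix l u).Eval v) :=
  ⟨False.elim, fun _ => trivial, fun _ _ hlu => h.minFix hlu⟩

theorem achieves_self (p l u : Prop) : Achieves p p l u p :=
  ⟨id, id, fun h h' => absurd h' h⟩

theorem SoundAt.achieves_repair (h : r.SoundAt v) (f : Fml α) (s : Finset Path) (l u : Fml α) :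
    Achieves ((f.createBounds s).1.Eval v) ((f.createBounds s).2.Eval v) (l.Eval v) (u.Eval v)
      ((f.repair s (r.deriveFixes f s l u)).Eval v) := by
  induction f generalizing s l u with
  | not f ih =>
    by_cases hs : [] ∈ s
    · rw [Fml.repair_root _ _ hs, Fml.createBounds_root _ hs, deriveFixes_root _ hs]
      exact achieves_minFix h l u
    · have := (ih (below s 0) u.not l.not).not
      simpa [Fml.createBounds, Fml.repair, hs, Fml.Eval, deriveFixes] using this
  | node op n c ih =>
    by_cases hs : [] ∈ s
    · rw [Fml.repair_root _ _ hs, Fml.createBounds_root _ hs, deriveFixes_root _ hs]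
      exact achieves_minFix h l u
    · let G : Fin n → Fml α := fun i => (c i).repair (below s i) fun p =>
        r.deriveFixes (.node op n c) s l u (i.val :: p)
      have hG : (Fml.node op n c).repair s (r.deriveFixes (.node op n c) s l u) =
          .node op n G := by
        simp only [Fml.repair, hs, if_false]
        rfl
      have hb : (Fml.node op n c).createBounds s =
          (.node op n fun i => ((c i).createBounds (below s i)).1,
            .node op n fun i => ((c i).createBounds (below s i)).2) := by
        simp only [Fml.createBounds, hs, if_false]
      have hbR : ∀ i ∈ (siteChildren s n : Set (Fin n)),
          (c i).createBounds (below s i) = (.fls, .tru) := fun i hi =>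
        Fml.createBounds_root _ (nil_mem_below.2 (mem_siteChildren.1 hi))
      have hGR : ∀ i (hi : i ∈ siteChildren s n), G i =
          r.distributeFixes op c (siteChildren s n) ⟨i, hi⟩
            (r.minFix (jointTarget op c s l u).1 (jointTarget op c s l u).2) i := fun i hi => by
        rw [← deriveFixes_site c hs l u i hi []]
        exact Fml.repair_root _ _ (nil_mem_below.2 (mem_siteChildren.1 hi))
      have hGC : ∀ i ∉ siteChildren s n, G i = (c i).repair (below s i)
          (r.deriveFixes (c i) (below s i) (childTarget op c s l u i).1
            (childTarget op c s l u i).2) := fun i hi =>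
        congrArg _ (funext fun p => deriveFixes_nonsite c hs l u i hi p)
      rw [hG, hb]
      cases op with
      | and =>
        refine Achieves.forall (R := siteChildren s n) (fun i hi => ?_) (fun i hi => ?_)
          (fun i hi => ?_) fun hR hlu => ?_
        · have := ih i (below s i) (childTarget .and c s l u i).1 (childTarget .and c s l u i).2
          rw [← hGC i hi, (eval_childTarget_and c s l u i).1,
            (eval_childTarget_and c s l u i).2] at this
          exact this
        · dsimp only; rw [hbR i hi]; exact id
        · dsimp only; rw [hbR i hi]; trivial
        · have hJ := h.minFix (l := (jointTarget .and c s l u).1)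
            (u := (jointTarget .and c s l u).2)
          rw [(eval_jointTarget_and c s l u).1, (eval_jointTarget_and c s l u).2,
            ← forall_distributeFixes_and (r := r) (v := v) c (siteChildren s n) hR
              (r.minFix _ _)] at hJ
          have hiff : (∀ i ∈ (siteChildren s n : Set (Fin n)), (G i).Eval v) ↔
              ∀ i ∈ siteChildren s n, (r.distributeFixes .and c (siteChildren s n) hR
                (r.minFix (jointTarget .and c s l u).1 (jointTarget .and c s l u).2) i).Eval v :=
            forall₂_congr fun i hi => by rw [hGR i hi]
          rw [hiff]
          exact hJ hlu
      | or =>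
        refine Achieves.exists (R := siteChildren s n) (fun i hi => ?_) (fun i hi => ?_)
          (fun i hi => ?_) fun hR hlu => ?_
        · have := ih i (below s i) (childTarget .or c s l u i).1 (childTarget .or c s l u i).2
          rw [← hGC i hi, (eval_childTarget_or c s l u i).1,
            (eval_childTarget_or c s l u i).2] at this
          exact this
        · dsimp only; rw [hbR i hi]; exact id
        · dsimp only; rw [hbR i hi]; trivial
        · have hJ := h.minFix (l := (jointTarget .or c s l u).1)
            (u := (jointTarget .or c s l u).2)
          rw [(eval_jointTarget_or c s l u).1, (eval_jointTarget_or c s l u).2,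
            ← exists_distributeFixes_or (r := r) (v := v) c (siteChildren s n) hR
              (r.minFix _ _)] at hJ
          have hiff : (∃ i ∈ (siteChildren s n : Set (Fin n)), (G i).Eval v) ↔
              ∃ i ∈ siteChildren s n, (r.distributeFixes .or c (siteChildren s n) hR
                (r.minFix (jointTarget .or c s l u).1 (jointTarget .or c s l u).2) i).Eval v :=
            exists_congr fun i => and_congr_right fun hi => by rw [hGR i hi]
          rw [hiff]
          exact hJ hlu
  | _ =>
    by_cases hs : [] ∈ s
    · rw [Fml.repair_root _ _ hs, Fml.createBounds_root _ hs, deriveFixes_root _ hs]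
      exact achieves_minFix h l u
    · simp only [Fml.createBounds, Fml.repair, hs, if_false]
      exact achieves_self _ _ _

/-! ### The search for a repair -/

/-- The repair `(s, F)` is one for which the search establishes the repair bounds. -/
def Candidate (r : Repairer α) (P Ps : Fml α) (x : Finset Path × (Path → Fml α)) : Prop :=
  r.Implies (P.createBounds x.1).1 Ps ∧ r.Implies Ps (P.createBounds x.1).2 ∧
    x.2 = r.deriveFixes P x.1 Ps Ps

theorem candidate_search {P Ps : Fml α} (L : List (Finset Path))
    (best : WithTop ℝ × Finset Path × (Path → Fml α))
    (h : r.Candidate P Ps best.2 ∨ best.1 = ⊤ ∧ {[]} ∈ L) :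
    r.Candidate P Ps (r.search P Ps L best) := by
  induction L generalizing best with
  | nil => simpa [search] using h
  | cons s L ih =>
    rw [search]
    split_ifs with h₁ h₂
    · refine h.resolve_right fun ⟨htop, _⟩ => ?_
      rw [htop] at h₁
      exact WithTop.coe_ne_top (top_le_iff.1 h₁)
    · dsimp only
      split_ifs with h₃
      · exact ih _ (.inl ⟨h₂.1, h₂.2, rfl⟩)
      · refine ih _ (.inl (h.resolve_right fun ⟨htop, _⟩ => h₃ ?_))
        rw [htop]
        exact WithTop.coe_lt_top _
    · refine ih _ (h.imp_right fun ⟨htop, hmem⟩ => ⟨htop, ?_⟩)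
      refine (List.mem_cons.1 hmem).resolve_left ?_
      -- The bounds `[FALSE, TRUE]` of the whole tree are established without the solver.
      rintro rfl
      rw [Fml.createBounds_root _ (Finset.mem_singleton_self _)] at h₂
      exact h₂ ⟨.inl rfl, .inr (.inl rfl)⟩

theorem Sound.candidate {M : Set (α → Prop)} (h : r.Sound M) (P Ps : Fml α) :
    r.Candidate P Ps (r.repairCondition P Ps) := by
  refine candidate_search _ _ (.inr ⟨rfl, ((h.2.2.1 P r.cap).1 _).2 ⟨⟨?_, ?_⟩, ?_⟩⟩)
  · intro p hp
    rw [Finset.mem_singleton.1 hp]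
    cases P <;> trivial
  · intro p hp q hq _
    rw [Finset.mem_singleton.1 hp, Finset.mem_singleton.1 hq]
  · simpa using h.2.2.2.2

/-- The repaired condition is equivalent to the target in all models. -/
theorem Sound.eval_repaired {M : Set (α → Prop)} (h : r.Sound M) (P Ps : Fml α) (hv : v ∈ M) :
    (r.repaired P Ps).Eval v ↔ Ps.Eval v := by
  obtain ⟨h₁, h₂, h₃⟩ := h.candidate P Ps
  have hs := h.soundAt hv
  obtain ⟨a₁, a₂, a₃⟩ := hs.achieves_repair P (r.repairCondition P Ps).1 Ps Ps
  rw [← h₃] at a₁ a₂ a₃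
  have b₁ := hs.implies h₁
  have b₂ := hs.implies h₂
  unfold repaired
  tauto

theorem Sound.repaired_atoms {M : Set (α → Prop)} (h : r.Sound M) {P Ps : Fml α} {a : α}
    (ha : a ∈ (r.repaired P Ps).atoms) : a ∈ P.atoms ∨ a ∈ Ps.atoms := by
  refine repair_atoms P _ _ (X := {a | a ∈ P.atoms ∨ a ∈ Ps.atoms}) (fun a ha => .inl ha)
    (fun p => ?_) a ha
  rw [(h.candidate P Ps).2.2]
  exact deriveFixes_atoms _ _ _ _ _ (fun a ha => .inl ha) (fun a ha => .inr ha)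
    fun a ha => .inr ha

end Repairer

variable {S : Schema} {A B : Type}

/-! ### Renaming aliases -/

/-- The tuple over the aliases `A` that a tuple over the aliases `B` amounts to when every `a` is
renamed to `m a`. -/
def Env.pull (m : A → B) (ρ : Env S B) : Env S A := fun a => ρ (m a)

namespace Expr

@[simp] theorem eval_rename (m : A → B) (ρ : Env S B) {τ : Ty} (e : Expr S A τ) :
    (e.rename m).eval ρ = e.eval (ρ.pull m) := by
  induction e with
  | lit v => rfl
  | col a T c => rfl
  | app₁ f e ih => simp [rename, eval, ih]
  | app₂ f e₁ e₂ ih₁ ih₂ => simp [rename, eval, ih₁, ih₂]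

theorem refs_rename (m : A → B) {τ : Ty} (e : Expr S A τ) :
    (e.rename m).refs = (fun x => (m x.1, x.2)) '' e.refs := by
  induction e with
  | lit v => simp [rename, refs]
  | col a T c => simp [rename, refs]
  | app₁ f e ih => simpa [rename, refs] using ih
  | app₂ f e₁ e₂ ih₁ ih₂ => simp [rename, refs, ih₁, ih₂, Set.image_union]

theorem rename_congr {m m' : A → B} {τ : Ty} (e : Expr S A τ)
    (h : ∀ x ∈ e.refs, m x.1 = m' x.1) : e.rename m = e.rename m' := by
  induction e with
  | lit v => rfl
  | col a T c => simp [rename, h (a, T) rfl]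
  | app₁ f e ih => exact congrArg (app₁ f) (ih h)
  | app₂ f e₁ e₂ ih₁ ih₂ =>
    exact congrArg₂ (app₂ f) (ih₁ fun x hx => h x (.inl hx)) (ih₂ fun x hx => h x (.inr hx))

end Expr

namespace GExpr

theorem refs_rename (m : A → B) {τ : Ty} (e : GExpr S A τ) :
    (e.rename m).refs = (fun x => (m x.1, x.2)) '' e.refs := by
  induction e with
  | row e => exact e.refs_rename m
  | agg f d e => exact e.refs_rename m
  | app₁ f e ih => simpa [rename, refs] using ih
  | app₂ f e₁ e₂ ih₁ ih₂ => simp [rename, refs, ih₁, ih₂, Set.image_union]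

theorem rename_congr {m m' : A → B} {τ : Ty} (e : GExpr S A τ)
    (h : ∀ x ∈ e.refs, m x.1 = m' x.1) : e.rename m = e.rename m' := by
  induction e with
  | row e => exact congrArg row (e.rename_congr h)
  | agg f d e => exact congrArg (agg f d) (e.rename_congr h)
  | app₁ f e ih => exact congrArg (app₁ f) (ih h)
  | app₂ f e₁ e₂ ih₁ ih₂ =>
    exact congrArg₂ (app₂ f) (ih₁ fun x hx => h x (.inl hx)) (ih₂ fun x hx => h x (.inr hx))

theorem rowParts_rename (m : A → B) {τ : Ty} (e : GExpr S A τ) :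
    (e.rename m).rowParts = (fun x => ⟨x.1, x.2.rename m⟩) '' e.rowParts := by
  induction e with
  | row e => simp [rename, rowParts]
  | agg f d e => simp [rename, rowParts]
  | app₁ f e ih => simpa [rename, rowParts] using ih
  | app₂ f e₁ e₂ ih₁ ih₂ => simp [rename, rowParts, ih₁, ih₂, Set.image_union]

/-- The representative of the renamed group need not be the renamed representative, so the
expressions outside aggregate calls must not depend on the choice. -/
theorem eval_rename (m : A → B) (I : AggInterp) (g : Multiset (Env S B)) {τ : Ty}
    (e : GExpr S A τ)
    (h : ∀ x ∈ e.rowParts, x.2.eval ((rep g).pull m) = x.2.eval (rep (g.map (Env.pull m)))) :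
    (e.rename m).eval I g = e.eval I (g.map (Env.pull m)) := by
  induction e with
  | row e => exact (e.eval_rename m _).trans (h ⟨_, e⟩ rfl)
  | agg f d e => simp [rename, eval, Multiset.map_map]
  | app₁ f e ih => simp [rename, eval, ih h]
  | app₂ f e₁ e₂ ih₁ ih₂ =>
    simp [rename, eval, ih₁ fun x hx => h x (.inl hx), ih₂ fun x hx => h x (.inr hx)]

end GExpr

namespace Atom

variable {E F : Ty → Type} {X Y : Type}

theorem holds_map (f : (τ : Ty) → E τ → F τ) (val : (τ : Ty) → F τ → τ.Val) (a : Atom E) :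
    (a.map f).Holds val ↔ a.Holds fun τ e => val τ (f τ e) := by
  cases a <;> rfl

theorem collect_map (f : (τ : Ty) → E τ → F τ) (r : (τ : Ty) → F τ → Set X) (a : Atom E) :
    (a.map f).collect r = a.collect fun τ e => r τ (f τ e) := by
  cases a <;> rfl

theorem collect_image (r : (τ : Ty) → E τ → Set X) (φ : X → Y) (a : Atom E) :
    (a.collect fun τ e => φ '' r τ e) = φ '' a.collect r := by
  cases a <;> simp [collect, Set.image_union]

theorem map_congr {f g : (τ : Ty) → E τ → F τ} (r : (τ : Ty) → E τ → Set X) (p : X → Prop)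
    (h : ∀ τ e, (∀ x ∈ r τ e, p x) → f τ e = g τ e) (a : Atom E) (ha : ∀ x ∈ a.collect r, p x) :
    a.map f = a.map g := by
  cases a with
  | cmp op e₁ e₂ =>
    exact congrArg₂ (cmp op) (h _ _ fun x hx => ha x (.inl hx)) (h _ _ fun x hx => ha x (.inr hx))
  | like e q =>
    exact congrArg₂ like (h _ _ fun x hx => ha x (.inl hx)) (h _ _ fun x hx => ha x (.inr hx))

theorem holds_congr {val val' : (τ : Ty) → E τ → τ.Val} (r : (τ : Ty) → E τ → Set X)
    (p : X → Prop) (h : ∀ τ e, (∀ x ∈ r τ e, p x) → val τ e = val' τ e) (a : Atom E)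
    (ha : ∀ x ∈ a.collect r, p x) : a.Holds val ↔ a.Holds val' := by
  cases a with
  | cmp op e₁ e₂ =>
    simp only [Holds, h _ e₁ fun x hx => ha x (.inl hx), h _ e₂ fun x hx => ha x (.inr hx)]
  | like e q =>
    simp only [Holds, h _ e fun x hx => ha x (.inl hx), h _ q fun x hx => ha x (.inr hx)]

end Atom

theorem rowHolds_rename (m : A → B) (ρ : Env S B) (P : Fml (RAtom S A)) :
    RowHolds ρ (P.map (Atom.map fun _ e => e.rename m)) ↔ RowHolds (ρ.pull m) P := by
  unfold RowHolds
  rw [Fml.eval_map]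
  refine P.eval_congr fun a _ => ?_
  rw [Atom.holds_map]
  simp

theorem exprs_eval_rename (m : A → A) (ρ : Env S A) (o : Exprs S A) :
    (renameExprs m o).eval ρ = o.eval (ρ.pull m) := by
  simp [Exprs.eval, renameExprs]

theorem exprs_eval_eq_iff {ρ₁ ρ₂ : Env S A} {o : Exprs S A} :
    o.eval ρ₁ = o.eval ρ₂ ↔ ∀ e ∈ o, e.2.eval ρ₁ = e.2.eval ρ₂ := by
  simp [Exprs.eval]

/-! ### The rows of a `FROM` clause -/

theorem rows_perm (D : Database S) {F F' : From S A} (h : F.Perm F')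
    (hF : (F.map Prod.fst).Nodup) : From.rows D F = From.rows D F' := by
  induction h with
  | nil => rfl
  | cons x _ ih =>
    simp only [From.rows, ih (List.nodup_cons.1 hF).2]
  | swap x y F =>
    obtain ⟨a, T⟩ := x
    obtain ⟨b, U⟩ := y
    have hab : b ≠ a := by
      simp only [List.map_cons, List.nodup_cons, List.mem_cons, not_or] at hF
      exact hF.1.1
    simp only [From.rows, Multiset.map_bind, Multiset.map_map]
    rw [Multiset.bind_bind]
    refine Multiset.bind_congr fun r _ => Multiset.bind_congr fun r' _ =>
      Multiset.map_congr rfl fun ρ _ => ?_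
    simp only [Function.comp_apply, Function.update_of_ne hab, Function.update_of_ne hab.symm]
    exact Function.update_comm hab.symm _ _ _
  | trans h₁ _ ih₁ ih₂ => exact (ih₁ hF).trans (ih₂ ((h₁.map Prod.fst).nodup_iff.1 hF))

theorem rows_rename (D : Database S) {m : A → A} (hm : m.Injective) (F : From S A) :
    (From.rows D (F.rename m)).map (Env.pull m) = From.rows D F := by
  induction F with
  | nil => rfl
  | cons x F ih =>
    obtain ⟨a, T⟩ := x
    simp only [From.rename, List.map_cons, From.rows, Multiset.map_bind, Multiset.map_map]
      at ih ⊢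
    simp only [← ih, Multiset.map_map]
    refine Multiset.bind_congr fun r _ => Multiset.map_congr rfl fun ρ _ => ?_
    exact Function.update_comp_eq_of_injective _ hm _ _

theorem fromWhere_rename (D : Database S) {m : A → A} (hm : m.Injective) (F : From S A)
    (P : Fml (RAtom S A)) :
    (fromWhere D (F.rename m) (P.map (Atom.map fun _ e => e.rename m))).map (Env.pull m) =
      fromWhere D F P := by
  unfold fromWhere
  rw [← rows_rename D hm F, Multiset.filter_map]
  congr 1
  exact Multiset.filter_congr fun ρ _ => rowHolds_rename m ρ P

theorem fromWhere_congr (D : Database S) {F F' : From S A} {P P' : Fml (RAtom S A)}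
    (h : F.Perm F') (hF : (F.map Prod.fst).Nodup) (hP : ∀ ρ, RowHolds ρ P ↔ RowHolds ρ P') :
    fromWhere D F P = fromWhere D F' P' := by
  rw [fromWhere, rows_perm D h hF]
  exact Multiset.filter_congr fun ρ _ => hP ρ

/-! ### Groups -/

theorem mem_partition {o : Exprs S A} {R g : Multiset (Env S A)} :
    g ∈ partition o R ↔ ∃ ρ ∈ R, g = R.filter fun ρ' => o.eval ρ' = o.eval ρ := by
  simp [partition, eq_comm]

theorem nodup_partition (o : Exprs S A) (R : Multiset (Env S A)) : (partition o R).Nodup := by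
  refine Multiset.Nodup.map_on (fun k hk k' _ h => ?_) (Multiset.nodup_dedup _)
  simp only [Multiset.mem_dedup, Multiset.mem_map] at hk
  obtain ⟨ρ, hρ, rfl⟩ := hk
  have : ρ ∈ R.filter fun ρ' => o.eval ρ' = k' := h ▸ Multiset.mem_filter.2 ⟨hρ, rfl⟩
  exact (Multiset.mem_filter.1 this).2

theorem partition_congr {o o' : Exprs S A} {R : Multiset (Env S A)}
    (h : ∀ ρ₁ ∈ R, ∀ ρ₂ ∈ R, o.eval ρ₁ = o.eval ρ₂ ↔ o'.eval ρ₁ = o'.eval ρ₂) :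
    partition o R = partition o' R := by
  refine (Multiset.Nodup.ext (nodup_partition _ _) (nodup_partition _ _)).2 fun g => ?_
  rw [mem_partition, mem_partition]
  refine exists_congr fun ρ => and_congr_right fun hρ => ?_
  rw [Multiset.filter_congr fun ρ' hρ' => h ρ' hρ' ρ hρ]

theorem partition_rename (m : A → A) (o : Exprs S A) (R : Multiset (Env S A)) :
    (partition (renameExprs m o) R).map (Multiset.map (Env.pull m)) =
      partition o (R.map (Env.pull m)) := by
  simp only [partition, Multiset.map_map, exprs_eval_rename, Function.comp_def,
    Multiset.filter_map]

theorem isGroup_of_mem_partition {D : Database S} {F : From S A} {P : Fml (RAtom S A)}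
    {o : Exprs S A} {g : Multiset (Env S A)} (hg : g ∈ partition o (fromWhere D F P)) :
    IsGroup P o g := by
  obtain ⟨ρ, hρ, rfl⟩ := mem_partition.1 hg
  refine ⟨fun h => ?_, fun ρ' hρ' => ?_, fun _ h₁ _ h₂ => ?_⟩
  · have : ρ ∈ (0 : Multiset (Env S A)) := h ▸ Multiset.mem_filter.2 ⟨hρ, rfl⟩
    simp at this
  · exact (Multiset.mem_filter.1 (Multiset.mem_filter.1 hρ').1).2
  · exact (Multiset.mem_filter.1 h₁).2.trans (Multiset.mem_filter.1 h₂).2.symm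

theorem rep_mem {g : Multiset (Env S A)} (hg : g ≠ 0) : rep g ∈ g := by
  have h := Multiset.exists_mem_of_ne_zero hg
  rw [rep, dif_pos h]
  exact h.choose_spec

theorem Determined.congr {P P' : Fml (RAtom S A)} {o o' : Exprs S A} {e : Σ τ : Ty, Expr S A τ}
    (h : Determined P o e) (hP : ∀ ρ, RowHolds ρ P' → RowHolds ρ P)
    (ho : ∀ ρ₁ ρ₂, RowHolds ρ₁ P → RowHolds ρ₂ P → o'.eval ρ₁ = o'.eval ρ₂ →
      o.eval ρ₁ = o.eval ρ₂) : Determined P' o' e :=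
  fun ρ₁ ρ₂ h₁ h₂ h₁₂ => h ρ₁ ρ₂ (hP _ h₁) (hP _ h₂) (ho _ _ (hP _ h₁) (hP _ h₂) h₁₂)

theorem Determined.eval_rep {P : Fml (RAtom S A)} {o : Exprs S A} {e : Σ τ : Ty, Expr S A τ}
    (h : Determined P o e) {g : Multiset (Env S A)} (hg : IsGroup P o g) {ρ : Env S A}
    (hρ : ρ ∈ g) : e.2.eval ρ = e.2.eval (rep g) :=
  h _ _ (hg.2.1 _ hρ) (hg.2.1 _ (rep_mem hg.1)) (hg.2.2 _ hρ _ (rep_mem hg.1))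

theorem IsGroup.congr {P P' : Fml (RAtom S A)} {o o' : Exprs S A} {g : Multiset (Env S A)}
    (hg : IsGroup P o g) (hP : ∀ ρ, RowHolds ρ P → RowHolds ρ P')
    (ho : ∀ ρ₁ ρ₂, RowHolds ρ₁ P → RowHolds ρ₂ P → o.eval ρ₁ = o.eval ρ₂ →
      o'.eval ρ₁ = o'.eval ρ₂) : IsGroup P' o' g :=
  ⟨hg.1, fun ρ hρ => hP ρ (hg.2.1 ρ hρ), fun _ h₁ _ h₂ =>
    ho _ _ (hg.2.1 _ h₁) (hg.2.1 _ h₂) (hg.2.2 _ h₁ _ h₂)⟩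

/-! ### Renamed queries -/

theorem From.Covers.rename {F : From S A} {r : Set (A × S.Table)} (h : F.Covers r) (m : A → A) :
    (F.rename m).Covers ((fun x => (m x.1, x.2)) '' r) := by
  rintro _ ⟨x, hx, rfl⟩
  exact List.mem_map.2 ⟨x, h x hx, rfl⟩

theorem From.Covers.of_perm {F F' : From S A} {r : Set (A × S.Table)} (h : F.Covers r)
    (hF : F.Perm F') : F'.Covers r :=
  fun x hx => hF.mem_iff.1 (h x hx)

theorem aliases_of_covers {F : From S A} {r : Set (A × S.Table)} (h : F.Covers r) {m m' : A → A}
    (hm : ∀ x ∈ F, m x.1 = m' x.1) : ∀ x ∈ r, m x.1 = m' x.1 :=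
  fun x hx => hm x (h x hx)

theorem From.rename_congr {F : From S A} {m m' : A → A} (hm : ∀ x ∈ F, m x.1 = m' x.1) :
    F.rename m = F.rename m' :=
  List.map_congr_left fun x hx => by rw [hm x hx]

theorem ValidFromWhere.rename {F : From S A} {P : Fml (RAtom S A)} (h : ValidFromWhere F P)
    {m : A → A} (hm : m.Injective) :
    ValidFromWhere (F.rename m) (P.map (Atom.map fun _ e => e.rename m)) := by
  refine ⟨by simpa [From.rename] using h.1, ?_, fun a ha => ?_⟩
  · have := h.2.1.map hm
    simpa [From.rename, Function.comp_def] using this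
  · obtain ⟨b, hb, rfl⟩ := Fml.mem_atoms_map.1 ha
    simp only [Atom.collect_map, Expr.refs_rename, Atom.collect_image]
    exact (h.2.2 b hb).rename m

theorem cond_rename_congr {F : From S A} {P : Fml (RAtom S A)} (h : ValidFromWhere F P)
    {m m' : A → A} (hm : ∀ x ∈ F, m x.1 = m' x.1) :
    P.map (Atom.map fun _ e => e.rename m) = P.map (Atom.map fun _ e => e.rename m') :=
  P.map_congr fun a ha => Atom.map_congr (fun _ => Expr.refs) (· ∈ F)
    (fun _ e he => e.rename_congr (aliases_of_covers he hm)) a (h.2.2 a ha)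

theorem Determined.rename {P : Fml (RAtom S A)} {o : Exprs S A} {e : Σ τ : Ty, Expr S A τ}
    (h : Determined P o e) (m : A → A) :
    Determined (P.map (Atom.map fun _ e => e.rename m)) (renameExprs m o)
      ⟨e.1, e.2.rename m⟩ := by
  intro ρ₁ ρ₂ h₁ h₂ h₁₂
  rw [rowHolds_rename] at h₁ h₂
  rw [exprs_eval_rename, exprs_eval_rename] at h₁₂
  simpa using h _ _ h₁ h₂ h₁₂

namespace FlatQuery

theorem rename_congr {Q : FlatQuery S A} (hQ : Q.Valid) {m m' : A → A}
    (hm : ∀ x ∈ Q.frm, m x.1 = m' x.1) : Q.rename m = Q.rename m' := by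
  unfold rename
  congr 1
  · exact From.rename_congr hm
  · exact cond_rename_congr hQ.1 hm
  · exact List.map_congr_left fun e he => by
      rw [e.2.rename_congr (aliases_of_covers (hQ.2.2 e he) hm)]

theorem Valid.rename {Q : FlatQuery S A} (hQ : Q.Valid) {m : A → A} (hm : m.Injective) :
    (Q.rename m).Valid := by
  refine ⟨hQ.1.rename hm, by simpa [FlatQuery.rename, renameExprs] using hQ.2.1, fun e he => ?_⟩
  obtain ⟨e', he', rfl⟩ := List.mem_map.1 he
  simp only [Expr.refs_rename]
  exact (hQ.2.2 e' he').rename m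

theorem rename_equiv (Q : FlatQuery S A) {m : A → A} (hm : m.Injective) :
    (Q.rename m).Equiv Q := by
  intro D
  simp only [result, FlatQuery.rename, ← fromWhere_rename D hm Q.frm Q.cond, Multiset.map_map,
    exprs_eval_rename, Function.comp_def]

/-- Queries that agree on the rows of their common tuples have the same results. -/
theorem equiv_of_viable {Qs T Q : FlatQuery S A} (hQ : Q.Valid) (hF : Q.frm.Perm T.frm)
    (h₁ : Qs.Viable T Q 1) (h₂ : Qs.Viable T Q 2) : Q.Equiv T := by
  intro D
  have hsel : ((fromWhere D Q.frm Q.cond).map fun ρ => Q.select.eval ρ) =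
      (fromWhere D Q.frm Q.cond).map fun ρ => T.select.eval ρ :=
    Multiset.map_congr rfl fun ρ hρ => h₂.2.2 ρ (Multiset.mem_filter.1 hρ).2
  simp only [result, h₂.1, ← fromWhere_congr D hF hQ.1.2.1 h₁, hsel]

end FlatQuery

namespace GroupedQuery

theorem rename_congr {Q : GroupedQuery S A} (hQ : Q.Valid) {m m' : A → A}
    (hm : ∀ x ∈ Q.frm, m x.1 = m' x.1) : Q.rename m = Q.rename m' := by
  obtain ⟨h₁, h₂, h₃, -, h₅⟩ := hQ
  unfold rename
  congr 1
  · exact From.rename_congr hm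
  · exact cond_rename_congr h₁ hm
  · exact List.map_congr_left fun e he => by
      rw [e.2.rename_congr (aliases_of_covers (h₂ e he) hm)]
  · exact Q.having.map_congr fun a ha => Atom.map_congr (fun _ => GExpr.refs) (· ∈ Q.frm)
      (fun _ e he => e.rename_congr (aliases_of_covers he hm)) a (h₃ a ha).1
  · exact List.map_congr_left fun e he => by
      rw [e.2.rename_congr (aliases_of_covers (h₅ e he).1 hm)]

theorem Valid.rename {Q : GroupedQuery S A} (hQ : Q.Valid) {m : A → A} (hm : m.Injective) :
    (Q.rename m).Valid := by
  obtain ⟨h₁, h₂, h₃, h₄, h₅⟩ := hQ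
  refine ⟨h₁.rename hm, fun e he => ?_, fun a ha => ?_,
    by simpa [GroupedQuery.rename, renameGExprs] using h₄, fun e he => ?_⟩
  · obtain ⟨e', he', rfl⟩ := List.mem_map.1 he
    simp only [Expr.refs_rename]
    exact (h₂ e' he').rename m
  · obtain ⟨a', ha', rfl⟩ := Fml.mem_atoms_map.1 ha
    simp only [Atom.collect_map, GExpr.refs_rename, GExpr.rowParts_rename, Atom.collect_image]
    refine ⟨(h₃ a' ha').1.rename m, ?_⟩
    rintro _ ⟨x, hx, rfl⟩
    exact Determined.rename ((h₃ a' ha').2 x hx) m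
  · obtain ⟨e', he', rfl⟩ := List.mem_map.1 he
    simp only [GExpr.refs_rename, GExpr.rowParts_rename]
    refine ⟨(h₅ e' he').1.rename m, ?_⟩
    rintro _ ⟨x, hx, rfl⟩
    exact Determined.rename ((h₅ e' he').2 x hx) m

theorem rename_equiv {Q : GroupedQuery S A} (hQ : Q.Valid) {m : A → A} (hm : m.Injective) :
    (Q.rename m).Equiv Q := by
  obtain ⟨-, -, h₃, -, h₅⟩ := hQ
  intro D
  have hrep : ∀ g ∈ partition (renameExprs m Q.keys) (fromWhere D (Q.frm.rename m)
      (Q.cond.map (Atom.map fun _ e => e.rename m))), ∀ x, Determined Q.cond Q.keys x →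
      x.2.eval ((rep g).pull m) = x.2.eval (rep (g.map (Env.pull m))) := by
    intro g hg x hx
    have hg' : IsGroup Q.cond Q.keys (g.map (Env.pull m)) := by
      refine isGroup_of_mem_partition (D := D) (F := Q.frm) ?_
      rw [← fromWhere_rename D hm, ← partition_rename]
      exact Multiset.mem_map_of_mem _ hg
    exact hx.eval_rep hg' (Multiset.mem_map_of_mem _ (rep_mem (isGroup_of_mem_partition hg).1))
  set G := partition (renameExprs m Q.keys) (fromWhere D (Q.frm.rename m)
    (Q.cond.map (Atom.map fun _ e => e.rename m)))
  have hG : partition Q.keys (fromWhere D Q.frm Q.cond) = G.map (Multiset.map (Env.pull m)) := by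
    rw [← fromWhere_rename D hm, ← partition_rename]
  have hhav : (G.filter fun g => GroupHolds stdAgg g (Q.rename m).having) =
      G.filter ((fun g => GroupHolds stdAgg g Q.having) ∘ Multiset.map (Env.pull m)) := by
    refine Multiset.filter_congr fun g hg => ?_
    simp only [GroupHolds, Function.comp_apply, GroupedQuery.rename, Fml.eval_map]
    refine Q.having.eval_congr fun a ha => ?_
    rw [Atom.holds_map]
    exact Atom.holds_congr (fun _ => GExpr.rowParts) (Determined Q.cond Q.keys)
      (fun τ e he => e.eval_rename m stdAgg g fun x hx => hrep g hg x (he x hx)) a (h₃ a ha).2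
  have hsel : ((G.filter fun g => GroupHolds stdAgg g (Q.rename m).having).map
        fun g => (Q.rename m).select.eval stdAgg g) =
      ((G.map (Multiset.map (Env.pull m))).filter fun g => GroupHolds stdAgg g Q.having).map
        fun g => Q.select.eval stdAgg g := by
    rw [Multiset.filter_map, Multiset.map_map, ← hhav]
    refine Multiset.map_congr rfl fun g hg => ?_
    simp only [GExprs.eval, GroupedQuery.rename, renameGExprs, List.map_map, Function.comp_apply]
    refine List.map_congr_left fun e he => ?_
    simp only [Function.comp_apply]
    rw [e.2.eval_rename m stdAgg g fun x hx =>
      hrep g (Multiset.mem_filter.1 hg).1 x ((h₅ e he).2 x hx)]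
  simp only [result]
  rw [hG, ← hsel]
  rfl

theorem equiv_of_viable {ctx : Set AggInterp} (hctx : stdAgg ∈ ctx) {Qs T Q : GroupedQuery S A}
    (hQ : Q.Valid) (hF : Q.frm.Perm T.frm) (h₁ : Qs.Viable ctx T Q 1) (h₂ : Qs.Viable ctx T Q 2)
    (h₃ : Qs.Viable ctx T Q 3) (h₄ : Qs.Viable ctx T Q 4) : Q.Equiv T := by
  intro D
  have hfw := fromWhere_congr D hF hQ.1.2.1 h₁
  have hpart : partition T.keys (fromWhere D T.frm T.cond) =
      partition Q.keys (fromWhere D Q.frm Q.cond) := by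
    rw [hfw]
    exact partition_congr fun ρ₁ hρ₁ ρ₂ hρ₂ =>
      (h₂ ρ₁ ρ₂ (Multiset.mem_filter.1 hρ₁).2 (Multiset.mem_filter.1 hρ₂).2).symm
  set G := partition Q.keys (fromWhere D Q.frm Q.cond) with hG
  have hhav : (G.filter fun g => GroupHolds stdAgg g Q.having) =
      G.filter fun g => GroupHolds stdAgg g T.having :=
    Multiset.filter_congr fun g hg => h₃ stdAgg hctx g (isGroup_of_mem_partition hg)
  have hsel : ((G.filter fun g => GroupHolds stdAgg g T.having).map
      fun g => Q.select.eval stdAgg g) =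
      (G.filter fun g => GroupHolds stdAgg g T.having).map fun g => T.select.eval stdAgg g :=
    Multiset.map_congr rfl fun g hg => h₄.2.2 stdAgg hctx g
      (isGroup_of_mem_partition (Multiset.mem_filter.1 hg).1)
  simp only [result, h₄.1, hpart, ← hG, hhav, hsel]

end GroupedQuery

/-! ### Moving conditions between `WHERE` and `HAVING` -/

theorem groupHolds_row (I : AggInterp) (g : Multiset (Env S A)) (c : Fml (RAtom S A)) :
    GroupHolds I g (c.map (Atom.map fun _ e => GExpr.row e)) ↔ RowHolds (rep g) c := by
  unfold GroupHolds RowHolds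
  rw [Fml.eval_map]
  refine c.eval_congr fun a _ => ?_
  rw [Atom.holds_map]
  rfl

theorem MovesCondition.equiv {q q' : GroupedQuery S A} (h : MovesCondition q q') :
    q.Equiv q' := by
  obtain ⟨hF, hK, hd, hs, c, hc, hconst, hhav⟩ := h
  intro D
  have hR : fromWhere D q.frm q.cond =
      (fromWhere D q'.frm q'.cond).filter fun ρ => RowHolds ρ c := by
    rw [fromWhere, fromWhere, Multiset.filter_filter, hF]
    exact Multiset.filter_congr fun ρ _ => by rw [hc, and_comm]
  suffices hg : (partition q.keys (fromWhere D q.frm q.cond)).filter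
        (fun g => GroupHolds stdAgg g q.having) =
      (partition q'.keys (fromWhere D q'.frm q'.cond)).filter
        (fun g => GroupHolds stdAgg g q'.having) by
    simp only [GroupedQuery.result, hg, hd, hs]
  rw [← hK] at hconst
  rw [hR, ← hK]
  -- A group of the tuples satisfying `c` is a whole group of all tuples.
  have hwhole : ∀ ρ ∈ fromWhere D q'.frm q'.cond, RowHolds ρ c →
      ((fromWhere D q'.frm q'.cond).filter fun ρ => RowHolds ρ c).filter
        (fun ρ' => q'.keys.eval ρ' = q'.keys.eval ρ) =
      (fromWhere D q'.frm q'.cond).filter fun ρ' => q'.keys.eval ρ' = q'.keys.eval ρ := by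
    intro ρ hρ hρc
    rw [Multiset.filter_filter]
    refine Multiset.filter_congr fun ρ' hρ' => ⟨And.left, fun h => ⟨h, ?_⟩⟩
    exact (hconst ρ' ρ (Multiset.mem_filter.1 hρ').2 (Multiset.mem_filter.1 hρ).2 h).2 hρc
  refine (Multiset.Nodup.ext ((nodup_partition _ _).filter _)
    ((nodup_partition _ _).filter _)).2 fun g => ?_
  simp only [Multiset.mem_filter]
  constructor
  · rintro ⟨hg, hH⟩
    obtain ⟨ρ, hρ, rfl⟩ := mem_partition.1 hg
    obtain ⟨hρ, hρc⟩ := Multiset.mem_filter.1 hρ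
    have hmem : ((fromWhere D q'.frm q'.cond).filter fun ρ => RowHolds ρ c).filter
        (fun ρ' => q'.keys.eval ρ' = q'.keys.eval ρ) ∈
          partition q'.keys (fromWhere D q'.frm q'.cond) :=
      mem_partition.2 ⟨ρ, hρ, hwhole ρ hρ hρc⟩
    have hgrp := isGroup_of_mem_partition hmem
    refine ⟨hmem, (hhav _ hgrp).2 ⟨hH, (groupHolds_row _ _ _).2 ?_⟩⟩
    exact (Multiset.mem_filter.1 (Multiset.mem_filter.1 (rep_mem hgrp.1)).1).2
  · rintro ⟨hg, hH⟩
    have hgrp := isGroup_of_mem_partition hg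
    obtain ⟨hH, hcg⟩ := (hhav g hgrp).1 hH
    rw [groupHolds_row] at hcg
    obtain ⟨ρ, hρ, rfl⟩ := mem_partition.1 hg
    have hrep := rep_mem hgrp.1
    have hρc : RowHolds ρ c := (hconst _ ρ (hgrp.2.1 _ hrep) (Multiset.mem_filter.1 hρ).2
      (Multiset.mem_filter.1 hrep).2).1 hcg
    exact ⟨mem_partition.2 ⟨ρ, Multiset.mem_filter.2 ⟨hρ, hρc⟩, (hwhole ρ hρ hρc).symm⟩, hH⟩

/-! ### Table mappings -/

theorem exists_perm_map_eq {L L' : List A} (h : L.length = L'.length) (hL : L.Nodup)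
    (hL' : L'.Nodup) : ∃ σ : Equiv.Perm A, L.map σ = L' := by
  induction L generalizing L' with
  | nil => exact ⟨1, by simpa [eq_comm] using h⟩
  | cons a L ih =>
    cases L' with
    | nil => simp at h
    | cons b L' =>
      rw [List.nodup_cons] at hL hL'
      obtain ⟨σ, rfl⟩ := ih (by simpa using h) hL.2 hL'.2
      -- Correcting the value at `a` leaves the values on `L` unchanged.
      refine ⟨σ.trans (Equiv.swap (σ a) b), ?_⟩
      simp only [List.map_cons, Equiv.trans_apply, Equiv.swap_apply_left, List.cons.injEq,
        true_and]
      refine List.map_congr_left fun x hx => Equiv.swap_apply_of_ne_of_ne ?_ ?_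
      · rintro h
        exact hL.1 (σ.injective h ▸ hx)
      · rintro rfl
        exact hL'.1 (List.mem_map_of_mem hx)

/-- A table mapping agrees on the aliases in use with a permutation of all aliases, so renaming
by it is injective without loss of generality. -/
theorem IsTableMapping.exists_perm {m : A → A} {Fs F : From S A} (hm : IsTableMapping m Fs F)
    (hFs : (Fs.map Prod.fst).Nodup) (hF : (F.map Prod.fst).Nodup) :
    ∃ σ : Equiv.Perm A, (∀ x ∈ Fs, m x.1 = σ x.1) ∧ (Fs.rename σ).Perm F := by
  have hnodup : ((Fs.map Prod.fst).map m).Nodup := by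
    refine List.Nodup.map_on (fun a ha b hb h => ?_) hFs
    obtain ⟨x, hx, rfl⟩ := List.mem_map.1 ha
    obtain ⟨y, hy, rfl⟩ := List.mem_map.1 hb
    exact hm.1.injOn ⟨x.2, hx⟩ ⟨y.2, hy⟩ h
  obtain ⟨σ, hσ⟩ := exists_perm_map_eq (by simp) hFs hnodup
  have hmσ : ∀ x ∈ Fs, m x.1 = σ x.1 := fun x hx =>
    (List.map_inj_left.1 hσ x.1 (List.mem_map_of_mem hx)).symm
  refine ⟨σ, hmσ, ?_⟩
  rw [← From.rename_congr hmσ]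
  have hnodup' : (Fs.rename m).Nodup := by
    refine List.Nodup.of_map Prod.fst ?_
    simpa [From.rename, Function.comp_def] using hnodup
  rw [List.perm_ext_iff_of_nodup hnodup' (List.Nodup.of_map Prod.fst hF)]
  rintro ⟨b, T⟩
  constructor
  · intro h
    obtain ⟨⟨a, U⟩, hx, h⟩ := List.mem_map.1 h
    obtain ⟨rfl, rfl⟩ := Prod.mk.inj h
    exact hm.2 a U hx
  · intro h
    obtain ⟨a, ⟨U, ha⟩, rfl⟩ := hm.1.surjOn ⟨T, h⟩
    have : ((m a, T) : A × S.Table) = (m a, U) :=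
      List.inj_on_of_nodup_map hF h (hm.2 a U ha) rfl
    obtain rfl : T = U := (Prod.mk.inj this).2
    exact List.mem_map.2 ⟨(a, T), ha, rfl⟩

theorem exists_perm_of_tables {Fs F : From S A} (h : F.tables = Fs.tables)
    (hFs : (Fs.map Prod.fst).Nodup) (hF : (F.map Prod.fst).Nodup) :
    ∃ σ : Equiv.Perm A, (Fs.rename σ).Perm F := by
  have hperm : (Fs.map Prod.snd).Perm (F.map Prod.snd) := by
    simpa [From.tables] using h.symm
  obtain ⟨F₁, h₁, h₂⟩ :=
    (congrFun (congrFun (List.eq_map_comp_perm Prod.snd) (Fs.map Prod.snd)) F).mpr hperm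
  have hlen : (Fs.map Prod.fst).length = (F₁.map Prod.fst).length := by
    simpa using congrArg List.length h₁
  obtain ⟨σ, hσ⟩ := exists_perm_map_eq hlen hFs ((h₂.map Prod.fst).nodup_iff.2 hF)
  refine ⟨σ, ?_⟩
  have : Fs.rename σ = F₁ := by
    rw [List.zip_of_prod hσ.symm h₁.symm]
    refine List.zip_of_prod ?_ ?_ <;> simp [From.rename, Function.comp_def]
  exact this ▸ h₂

/-! ### The `FROM` hint -/

theorem exists_tables_inter (F : From S A) (M : Multiset S.Table) :
    ∃ F₁ F₂ : From S A, F.Perm (F₁ ++ F₂) ∧ F₁.tables = F.tables ∩ M := by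
  induction F generalizing M with
  | nil => exact ⟨[], [], .nil, by simp [From.tables]⟩
  | cons x F ih =>
    have hx : From.tables (x :: F) = x.2 ::ₘ From.tables F := by simp [From.tables]
    by_cases hM : x.2 ∈ M
    · obtain ⟨F₁, F₂, h₁, h₂⟩ := ih (M.erase x.2)
      refine ⟨x :: F₁, F₂, h₁.cons x, ?_⟩
      rw [hx, Multiset.cons_inter_of_pos _ hM, ← h₂]
      simp [From.tables]
    · obtain ⟨F₁, F₂, h₁, h₂⟩ := ih M
      refine ⟨F₁, x :: F₂, (h₁.cons x).trans List.perm_middle.symm, ?_⟩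
      rw [hx, Multiset.cons_inter_of_neg _ hM, h₂]

theorem exists_fresh_references [Infinite A] {F : From S A} (hF : (F.map Prod.fst).Nodup)
    (K : Multiset S.Table) :
    ∃ F' : From S A, (F'.map Prod.fst).Nodup ∧ F'.tables = F.tables + K ∧ F ⊆ F' ∧
      ∀ x ∈ F', x ∈ F ∨ x.2 ∈ K := by
  induction K using Multiset.induction with
  | empty => exact ⟨F, hF, by simp, fun _ => id, fun x hx => .inl hx⟩
  | cons T K ih =>
    obtain ⟨F', h₁, h₂, h₃, h₄⟩ := ih
    obtain ⟨b, hb⟩ := Infinite.exists_notMem_finset (F'.map Prod.fst).toFinset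
    rw [List.mem_toFinset] at hb
    refine ⟨(b, T) :: F', List.nodup_cons.2 ⟨hb, h₁⟩, ?_, fun x hx => .tail _ (h₃ hx), ?_⟩
    · have : From.tables ((b, T) :: F') = T ::ₘ From.tables F' := by simp [From.tables]
      rw [this, h₂, Multiset.add_cons]
    · intro x hx
      rcases List.mem_cons.1 hx with rfl | hx
      · exact .inr (Multiset.mem_cons_self _ _)
      · exact (h₄ x hx).imp_right Multiset.mem_cons_of_mem

theorem exists_followsHint [Infinite A] (Fs : From S A) {F : From S A}
    (hF : (F.map Prod.fst).Nodup) :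
    ∃ F' : From S A, (F'.map Prod.fst).Nodup ∧ F'.tables = Fs.tables ∧ Fs.FollowsHint F F' := by
  obtain ⟨F₁, F₂, hperm, h₁⟩ := exists_tables_inter F Fs.tables
  have hnodup : (F₁.map Prod.fst).Nodup := by
    have := (hperm.map Prod.fst).nodup_iff.1 hF
    rw [List.map_append] at this
    exact this.of_append_left
  obtain ⟨F', h₂, h₃, h₄, h₅⟩ := exists_fresh_references hnodup (Fs.tables - F.tables)
  have htab : F'.tables = Fs.tables := by
    ext T
    rw [h₃, h₁]
    simp only [Multiset.count_add, Multiset.count_inter, Multiset.count_sub]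
    omega
  have hsum : F.tables = F₁.tables + F₂.tables := by
    have : ((F.map Prod.snd : List S.Table) : Multiset S.Table) =
        ((F₁ ++ F₂).map Prod.snd : List S.Table) := Multiset.coe_eq_coe.2 (hperm.map _)
    simpa [From.tables] using this
  refine ⟨F', h₂, htab, fun T => ⟨by rw [htab], fun hle a ha => ?_, fun hle a ha => ?_⟩⟩
  · rcases List.mem_append.1 (hperm.mem_iff.1 ha) with ha | ha
    · exact h₄ ha
    · have hmem : T ∈ F₂.tables := Multiset.mem_map.2 ⟨(a, T), by simpa using ha, rfl⟩
      have hpos := Multiset.count_pos.2 hmem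
      have hcount := congrArg (Multiset.count T) hsum
      rw [h₁, Multiset.count_add, Multiset.count_inter] at hcount
      omega
  · rcases h₅ _ ha with ha | ha
    · exact hperm.mem_iff.2 (List.mem_append_left _ ha)
    · have hpos : 0 < Multiset.count T (Fs.tables - F.tables) := Multiset.count_pos.2 ha
      rw [Multiset.count_sub] at hpos
      omega

/-! ### The `GROUP BY` hint -/

namespace QrHint

theorem eval_eq_of_not_canSplit {q : QrHint S A}
    (hq : ∀ φ, q.pairUnsat φ = true → ∀ ρ, ¬ RowHolds ρ φ) {P : Fml (RAtom S A)} {o : Exprs S A}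
    {e : Σ τ : Ty, Expr S A τ} (h : ¬ q.CanSplit P o e) {ρ₁ ρ₂ : Env S A} (h₁ : RowHolds ρ₁ P)
    (h₂ : RowHolds ρ₂ P) (ho : ∀ x ∈ o, x.2.eval ρ₁ = x.2.eval ρ₂) :
    e.2.eval ρ₁ = e.2.eval ρ₂ := by
  by_contra hne
  let ρ : Env S (A ⊕ A) := Sum.elim ρ₁ ρ₂
  have hl : ρ.pull Sum.inl = ρ₁ := rfl
  have hr : ρ.pull Sum.inr = ρ₂ := rfl
  refine hq _ (not_not.1 h) ρ ?_
  unfold RowHolds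
  rw [Fml.eval_big_and]
  simp only [List.mem_cons, List.not_mem_nil, or_false, forall_eq_or_imp, forall_eq,
    Fml.eval_big_and, List.mem_map, forall_exists_index, and_imp, forall_apply_eq_imp_iff₂]
  refine ⟨(rowHolds_rename _ ρ P).2 h₁, (rowHolds_rename _ ρ P).2 h₂, fun x hx => ?_, ?_⟩
  · simpa [twoTuples, Fml.Eval, Atom.Holds, CmpOp.Holds, hl, hr] using ho x hx
  · simpa [twoTuples, Fml.Eval, Atom.Holds, CmpOp.Holds, hl, hr] using hne

theorem mem_missingKeys {q : QrHint S A} {P : Fml (RAtom S A)} {cur es : Exprs S A}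
    {e : Σ τ : Ty, Expr S A τ} (he : e ∈ q.missingKeys P cur es) : e ∈ es := by
  induction es generalizing cur with
  | nil => exact he
  | cons x es ih =>
    rw [missingKeys] at he
    split_ifs at he
    · rcases List.mem_cons.1 he with rfl | he
      · exact .head _
      · exact .tail _ (ih he)
    · exact .tail _ (ih he)

theorem eval_eq_of_missingKeys {q : QrHint S A}
    (hq : ∀ φ, q.pairUnsat φ = true → ∀ ρ, ¬ RowHolds ρ φ) {P : Fml (RAtom S A)}
    {cur es : Exprs S A} {ρ₁ ρ₂ : Env S A} (h₁ : RowHolds ρ₁ P) (h₂ : RowHolds ρ₂ P)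
    (hcur : ∀ x ∈ cur, x.2.eval ρ₁ = x.2.eval ρ₂)
    (hnew : ∀ x ∈ q.missingKeys P cur es, x.2.eval ρ₁ = x.2.eval ρ₂) :
    ∀ x ∈ es, x.2.eval ρ₁ = x.2.eval ρ₂ := by
  induction es generalizing cur with
  | nil => simp
  | cons e es ih =>
    rw [missingKeys] at hnew
    split_ifs at hnew with h
    · rw [List.forall_mem_cons] at hnew ⊢
      refine ⟨hnew.1, ih (cur := cur ++ [e]) (fun x hx => ?_) hnew.2⟩
      rcases List.mem_append.1 hx with hx | hx
      · exact hcur x hx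
      · rw [List.mem_singleton.1 hx]; exact hnew.1
    · exact List.forall_mem_cons.2 ⟨eval_eq_of_not_canSplit hq h h₁ h₂ hcur, ih hcur hnew⟩

theorem mem_fixGrouping {q : QrHint S A} {P : Fml (RAtom S A)} {o os : Exprs S A}
    {e : Σ τ : Ty, Expr S A τ} (he : e ∈ q.fixGrouping P o os) : e ∈ o ∨ e ∈ os :=
  (List.mem_append.1 he).imp (fun h => (List.mem_filter.1 h).1) mem_missingKeys

theorem fixGrouping_eval_eq_iff {q : QrHint S A}
    (hq : ∀ φ, q.pairUnsat φ = true → ∀ ρ, ¬ RowHolds ρ φ) {P : Fml (RAtom S A)}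
    (o os : Exprs S A) {ρ₁ ρ₂ : Env S A} (h₁ : RowHolds ρ₁ P) (h₂ : RowHolds ρ₂ P) :
    (q.fixGrouping P o os).eval ρ₁ = (q.fixGrouping P o os).eval ρ₂ ↔
      os.eval ρ₁ = os.eval ρ₂ := by
  rw [exprs_eval_eq_iff, exprs_eval_eq_iff]
  constructor
  · intro h
    have h := List.forall_mem_append.1 h
    exact eval_eq_of_missingKeys hq h₁ h₂ h.1 h.2
  · intro h e he
    rcases List.mem_append.1 he with he | he
    · exact eval_eq_of_not_canSplit hq (by simpa using (List.mem_filter.1 he).2) h₁ h₂ h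
    · exact h e (mem_missingKeys he)

/-! ### The `SELECT` hint -/

theorem mem_fixSelect {E : Type} {same : E → E → Prop} {l l' : List E} {e : E}
    (he : e ∈ fixSelect same l l') : e ∈ l ∨ e ∈ l' := by
  induction l' generalizing l with
  | nil => cases l <;> simp [fixSelect] at he
  | cons x' l' ih =>
    cases l with
    | nil => exact .inr (by simpa [fixSelect] using he)
    | cons x l =>
      rw [fixSelect] at he
      rcases List.mem_cons.1 he with he | he
      · split_ifs at he
        · exact .inl (he ▸ .head _)
        · exact .inr (he ▸ .head _)
      · exact (ih he).imp (.tail _) (.tail _)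

theorem map_fixSelect {E X : Type} {same : E → E → Prop} (f : E → X)
    (hf : ∀ e e', same e e' → f e = f e') (l l' : List E) :
    (fixSelect same l l').map f = l'.map f := by
  induction l' generalizing l with
  | nil => cases l <;> rfl
  | cons x' l' ih =>
    cases l with
    | nil => rfl
    | cons x l =>
      rw [fixSelect, List.map_cons, List.map_cons, ih]
      split_ifs with h
      · rw [hf _ _ h]
      · rfl

theorem length_fixSelect {E : Type} (same : E → E → Prop) (l l' : List E) :
    (fixSelect same l l').length = l'.length := by
  simpa using congrArg List.length (map_fixSelect (same := same) (fun _ => ()) (by simp) l l')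

theorem SameOnRows.eval_eq {q : QrHint S A} (hq : q.row.Sound (rowModels S A))
    {P : Fml (RAtom S A)} {e e' : Σ τ : Ty, Expr S A τ} (h : q.SameOnRows P e e') {ρ : Env S A}
    (hρ : RowHolds ρ P) :
    (⟨e.1, e.2.eval ρ⟩ : Σ τ : Ty, τ.Val) = ⟨e'.1, e'.2.eval ρ⟩ := by
  obtain ⟨τ, x, x', rfl, rfl, h⟩ := h
  by_contra hne
  refine hq.1 _ h _ ⟨ρ, rfl⟩ ((Fml.eval_conj _ _).2 ⟨hρ, fun heq : x.eval ρ = x'.eval ρ => ?_⟩)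
  simp [heq] at hne

theorem eval_fixSelect_rows {q : QrHint S A} (hq : q.row.Sound (rowModels S A))
    {P : Fml (RAtom S A)} (l l' : Exprs S A) {ρ : Env S A} (hρ : RowHolds ρ P) :
    Exprs.eval ρ (fixSelect (q.SameOnRows P) l l') = Exprs.eval ρ l' :=
  map_fixSelect _ (fun _ _ h => h.eval_eq hq hρ) l l'

theorem SameOnGroups.eval_eq {q : QrHint S A} {ctx : Set AggInterp} {P : Fml (RAtom S A)}
    {o : Exprs S A} (hq : (q.group P o).Sound (groupModels ctx P o))
    {e e' : Σ τ : Ty, GExpr S A τ} (h : q.SameOnGroups P o e e') {I : AggInterp} (hI : I ∈ ctx)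
    {g : Multiset (Env S A)} (hg : IsGroup P o g) :
    (⟨e.1, e.2.eval I g⟩ : Σ τ : Ty, τ.Val) = ⟨e'.1, e'.2.eval I g⟩ := by
  obtain ⟨τ, x, x', rfl, rfl, h⟩ := h
  by_contra hne
  refine hq.1 _ h _ ⟨I, hI, g, hg, rfl⟩ fun heq : x.eval I g = x'.eval I g => ?_
  simp [heq] at hne

theorem eval_fixSelect_groups {q : QrHint S A} {ctx : Set AggInterp} {P : Fml (RAtom S A)}
    {o : Exprs S A} (hq : (q.group P o).Sound (groupModels ctx P o)) (l l' : GExprs S A)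
    {I : AggInterp} (hI : I ∈ ctx) {g : Multiset (Env S A)} (hg : IsGroup P o g) :
    GExprs.eval I g (fixSelect (q.SameOnGroups P o) l l') = GExprs.eval I g l' :=
  map_fixSelect _ (fun _ _ h => h.eval_eq hq hI hg) l l'

end QrHint

/-! ### Completing a query with clauses of the target -/

theorem ValidFromWhere.of_perm {F F' : From S A} {P : Fml (RAtom S A)} (h : ValidFromWhere F P)
    (hF : F.Perm F') : ValidFromWhere F' P :=
  ⟨fun h' => h.1 (by simpa [h'] using hF), (hF.map Prod.fst).nodup_iff.1 h.2.1,
    fun a ha => (h.2.2 a ha).of_perm hF⟩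

theorem ValidFromWhere.repaired {F : From S A} {P P' : Fml (RAtom S A)} {r : Repairer (RAtom S A)}
    {M : Set (RAtom S A → Prop)} (hr : r.Sound M) (h : ValidFromWhere F P)
    (h' : ValidFromWhere F P') : ValidFromWhere F (r.repaired P P') :=
  ⟨h.1, h.2.1, fun a ha => (hr.repaired_atoms ha).elim (h.2.2 a) (h'.2.2 a)⟩

theorem rowHolds_repaired {r : Repairer (RAtom S A)} (hr : r.Sound (rowModels S A))
    (P P' : Fml (RAtom S A)) (ρ : Env S A) : RowHolds ρ (r.repaired P P') ↔ RowHolds ρ P' :=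
  hr.eval_repaired P P' ⟨ρ, rfl⟩

theorem validFromWhere_tru {F Fs : From S A} (hF : (F.map Prod.fst).Nodup)
    (hFs : Fs ≠ []) (h : F.tables = Fs.tables) : ValidFromWhere F .tru := by
  refine ⟨?_, hF, by simp [Fml.atoms]⟩
  rintro rfl
  cases Fs with
  | nil => exact hFs rfl
  | cons x Fs => simpa [From.tables] using congrArg Multiset.card h

namespace FlatQuery

theorem Equiv.trans {Q Q' Q'' : FlatQuery S A} (h : Q.Equiv Q') (h' : Q'.Equiv Q'') :
    Q.Equiv Q'' :=
  fun D => (h D).trans (h' D)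

theorem Unifies.spec {Qs Q T : FlatQuery S A} (hT : Qs.Unifies Q T) (hQs : Qs.Valid)
    (hQ : Q.Valid) : T.Valid ∧ T.frm.Perm Q.frm ∧ T.Equiv Qs := by
  obtain ⟨m, hm, rfl⟩ := hT
  obtain ⟨σ, hσ, hperm⟩ := hm.exists_perm hQs.1.2.1 hQ.1.2.1
  rw [rename_congr hQs hσ]
  exact ⟨hQs.rename σ.injective, hperm, rename_equiv Qs σ.injective⟩

theorem valid_of_target {T : FlatQuery S A} (hT : T.Valid) {F : From S A} (hF : T.frm.Perm F)
    {P : Fml (RAtom S A)} (hP : ValidFromWhere F P) (d : Bool) {sel : Exprs S A} (h : sel ≠ [])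
    (hsel : ∀ e ∈ sel, e ∈ T.select ∨ F.Covers e.2.refs) : (FlatQuery.mk F P d sel).Valid :=
  ⟨hP, h, fun e he => (hsel e he).elim (fun he => (hT.2.2 e he).of_perm hF) id⟩

/-- A hint leads to a fix: the hinted clause is put in, later clauses are those of the target. In
the `FROM` stage the later clauses are arbitrary. -/
theorem exists_fix [Infinite A] {ctx : Set AggInterp} {q : QrHint S A} (hq : q.Sound ctx)
    {Qs : FlatQuery S A} (hQs : Qs.Valid) (i : Fin 3) (Q T : FlatQuery S A) (hQ : Q.Valid)
    (hT : i ≠ 0 → Qs.Unifies Q T) (hV : ∀ j < i, Qs.Viable T Q j) :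
    ∃ Q' : FlatQuery S A, Q'.Valid ∧ (∀ j ≤ i, Qs.Viable T Q' j) ∧
      Q.Consistent i.val Q' ∧ Qs.FollowsHint q T Q Q' i := by
  by_cases hi : i = 0
  · subst hi
    obtain ⟨F', h₁, h₂, h₃⟩ := exists_followsHint Qs.frm hQ.1.2.1
    refine ⟨⟨F', .tru, false, [⟨.int, .lit (0 : ℤ)⟩]⟩,
      ⟨validFromWhere_tru h₁ hQs.1.1 h₂, by simp, by simp [Expr.refs, From.Covers]⟩,
      fun j hj => ?_, by simp [Consistent], h₃⟩
    obtain rfl : j = 0 := by simpa using hj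
    exact h₂
  obtain ⟨hTv, hF, -⟩ := (hT hi).spec hQs hQ
  have hcov : ∀ e ∈ T.select, Q.frm.Covers e.2.refs := fun e he => (hTv.2.2 e he).of_perm hF
  fin_cases i
  · exact absurd rfl hi
  · refine ⟨⟨Q.frm, q.row.repaired Q.cond T.cond, T.distinct, T.select⟩,
      valid_of_target hTv hF (.repaired hq.1 hQ.1 (hTv.1.of_perm hF)) _ hTv.2.1
        fun e he => .inl he, fun j hj => ?_, by simp [Consistent], rfl⟩
    fin_cases j
    · exact hV 0 (by decide)
    · exact fun ρ => rowHolds_repaired hq.1 _ _ ρ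
    · exact absurd hj (by decide)
  · have hlen := QrHint.length_fixSelect (q.SameOnRows Q.cond) Q.select T.select
    refine ⟨⟨Q.frm, Q.cond, T.distinct, QrHint.fixSelect (q.SameOnRows Q.cond) Q.select T.select⟩,
      valid_of_target hTv hF hQ.1 _ ?_ fun e he =>
        (QrHint.mem_fixSelect he).symm.imp_right (hQ.2.2 e), fun j hj => ?_,
      by simp [Consistent], rfl, rfl⟩
    · rw [← List.length_pos_iff, hlen, List.length_pos_iff]
      exact hTv.2.1
    · fin_cases j
      · exact hV 0 (by decide)
      · exact hV 1 (by decide)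
      · exact ⟨rfl, hlen, fun ρ hρ => QrHint.eval_fixSelect_rows hq.1 _ _ hρ⟩

/-- A fix leads to eventual correctness: the clauses after stage `i` are those of the unified
target, and for the `FROM` stage those of the target renamed along some table mapping. -/
theorem exists_equiv {Qs : FlatQuery S A} (hQs : Qs.Valid) (i : Fin 3) (Q T : FlatQuery S A)
    (hQ : Q.Valid) (hT : i ≠ 0 → Qs.Unifies Q T) (hV : ∀ j ≤ i, Qs.Viable T Q j) :
    ∃ Q' : FlatQuery S A, Q'.Valid ∧ Q'.Equiv Qs ∧ Q.Consistent (i.val + 1) Q' := by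
  by_cases hi : i = 0
  · subst hi
    obtain ⟨σ, hF⟩ := exists_perm_of_tables (hV 0 le_rfl) hQs.1.2.1 hQ.1.2.1
    have hTv := hQs.rename σ.injective
    have hv := valid_of_target hTv hF (hTv.1.of_perm hF) Qs.distinct hTv.2.1 fun e he => .inl he
    refine ⟨_, hv, (equiv_of_viable (Qs := Qs) (T := Qs.rename σ) hv hF.symm (fun _ => Iff.rfl)
      ⟨rfl, rfl, fun _ _ => rfl⟩).trans (rename_equiv Qs σ.injective), by simp [Consistent]⟩
  obtain ⟨hTv, hF, hTQ⟩ := (hT hi).spec hQs hQ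
  fin_cases i
  · exact absurd rfl hi
  · have hv := valid_of_target hTv hF hQ.1 T.distinct hTv.2.1 fun e he => .inl he
    exact ⟨_, hv, (equiv_of_viable (Qs := Qs) hv hF.symm (hV 1 le_rfl)
      ⟨rfl, rfl, fun _ _ => rfl⟩).trans hTQ, by simp [Consistent]⟩
  · exact ⟨Q, hQ, (equiv_of_viable hQ hF.symm (hV 1 (by decide)) (hV 2 le_rfl)).trans hTQ,
      by simp [Consistent]⟩

end FlatQuery

namespace GroupedQuery

theorem Equiv.trans {Q Q' Q'' : GroupedQuery S A} (h : Q.Equiv Q') (h' : Q'.Equiv Q'') :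
    Q.Equiv Q'' :=
  fun D => (h D).trans (h' D)

theorem Unifies.spec {Qs Q T : GroupedQuery S A} (hT : Qs.Unifies Q T) (hQs : Qs.Valid)
    (hQ : Q.Valid) : T.Valid ∧ T.frm.Perm Q.frm ∧ T.Equiv Qs := by
  obtain ⟨hTv, m, hm, hmoves⟩ := hT
  obtain ⟨σ, hσ, hperm⟩ := hm.exists_perm hQs.1.2.1 hQ.1.2.1
  rw [rename_congr hQs hσ] at hmoves
  refine ⟨hTv, ?_⟩
  clear hTv
  induction hmoves with
  | refl => exact ⟨hperm, rename_equiv hQs σ.injective⟩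
  | tail _ hstep ih =>
    rcases hstep with h | h
    · exact ⟨h.1 ▸ ih.1, fun D => (h.equiv D).symm.trans (ih.2 D)⟩
    · exact ⟨h.1 ▸ ih.1, fun D => (h.equiv D).trans (ih.2 D)⟩

/-- Clauses of the target and of a well-formed query can be combined freely when the `WHERE`
conditions are equivalent and the `GROUP BY` lists induce the same groups. -/
theorem valid_of_target {T : GroupedQuery S A} (hT : T.Valid) {F : From S A}
    (hF : T.frm.Perm F) {P : Fml (RAtom S A)} (hPv : ValidFromWhere F P)
    (hP : ∀ ρ, RowHolds ρ P ↔ RowHolds ρ T.cond) {K : Exprs S A}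
    (hKv : ∀ e ∈ K, e ∈ T.keys ∨ F.Covers e.2.refs)
    (hK : ∀ ρ₁ ρ₂, RowHolds ρ₁ T.cond → RowHolds ρ₂ T.cond →
      (K.eval ρ₁ = K.eval ρ₂ ↔ T.keys.eval ρ₁ = T.keys.eval ρ₂)) {H : Fml (GAtom S A)}
    (hH : ∀ a ∈ H.atoms, a ∈ T.having.atoms ∨ (F.Covers (a.collect fun _ e => e.refs) ∧
      ∀ x ∈ a.collect fun _ e => e.rowParts, Determined P K x)) (d : Bool) {sel : GExprs S A}
    (h : sel ≠ []) (hsel : ∀ e ∈ sel, e ∈ T.select ∨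
      (F.Covers e.2.refs ∧ ∀ x ∈ e.2.rowParts, Determined P K x)) :
    (GroupedQuery.mk F P K H d sel).Valid := by
  have hdet : ∀ x, Determined T.cond T.keys x → Determined P K x := fun x hx =>
    hx.congr (fun ρ => (hP ρ).1) fun ρ₁ ρ₂ h₁ h₂ => (hK ρ₁ ρ₂ h₁ h₂).1
  refine ⟨hPv, fun e he => (hKv e he).elim (fun he => (hT.2.1 e he).of_perm hF) id,
    fun a ha => (hH a ha).elim (fun ha => ?_) id, h,
    fun e he => (hsel e he).elim (fun he => ?_) id⟩
  · exact ⟨(hT.2.2.1 a ha).1.of_perm hF, fun x hx => hdet x ((hT.2.2.1 a ha).2 x hx)⟩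
  · exact ⟨(hT.2.2.2.2 e he).1.of_perm hF, fun x hx => hdet x ((hT.2.2.2.2 e he).2 x hx)⟩

theorem exists_fix [Infinite A] {ctx : Set AggInterp} {q : QrHint S A} (hq : q.Sound ctx)
    {Qs : GroupedQuery S A} (hQs : Qs.Valid) (i : Fin 5) (Q T : GroupedQuery S A) (hQ : Q.Valid)
    (hT : i ≠ 0 → Qs.Unifies Q T) (hV : ∀ j < i, Qs.Viable ctx T Q j) :
    ∃ Q' : GroupedQuery S A, Q'.Valid ∧ (∀ j ≤ i, Qs.Viable ctx T Q' j) ∧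
      Q.Consistent i.val Q' ∧ Qs.FollowsHint q T Q Q' i := by
  by_cases hi : i = 0
  · subst hi
    obtain ⟨F', h₁, h₂, h₃⟩ := exists_followsHint Qs.frm hQ.1.2.1
    refine ⟨⟨F', .tru, [], .tru, false, [⟨.int, .row (.lit (0 : ℤ))⟩]⟩,
      ⟨validFromWhere_tru h₁ hQs.1.1 h₂, by simp, by simp [Fml.atoms], by simp, ?_⟩,
      fun j hj => ?_, by simp [Consistent], h₃⟩
    · simp [GExpr.refs, Expr.refs, From.Covers, GExpr.rowParts, Determined, Expr.eval]
    · obtain rfl : j = 0 := by simpa using hj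
      exact h₂
  obtain ⟨hTv, hF, -⟩ := (hT hi).spec hQs hQ
  fin_cases i
  · exact absurd rfl hi
  · refine ⟨⟨Q.frm, q.row.repaired Q.cond T.cond, T.keys, T.having, T.distinct, T.select⟩,
      valid_of_target hTv hF (.repaired hq.1 hQ.1 (hTv.1.of_perm hF)) (rowHolds_repaired hq.1 _ _)
        (fun e he => .inl he) (fun _ _ _ _ => Iff.rfl) (fun a ha => .inl ha) _ hTv.2.2.2.1
        fun e he => .inl he, fun j hj => ?_, by simp [Consistent], rfl⟩
    fin_cases j
    · exact hV 0 (by decide)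
    · exact fun ρ => rowHolds_repaired hq.1 _ _ ρ
    all_goals exact absurd hj (by decide)
  · have hK := fun ρ₁ ρ₂ (h₁ : RowHolds ρ₁ T.cond) (h₂ : RowHolds ρ₂ T.cond) =>
      QrHint.fixGrouping_eval_eq_iff hq.2.2 Q.keys T.keys h₁ h₂
    refine ⟨⟨Q.frm, Q.cond, q.fixGrouping T.cond Q.keys T.keys, T.having, T.distinct, T.select⟩,
      valid_of_target hTv hF hQ.1 (hV 1 (by decide))
        (fun e he => (QrHint.mem_fixGrouping he).symm.imp_right (hQ.2.1 e)) hK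
        (fun a ha => .inl ha) _ hTv.2.2.2.1 fun e he => .inl he, fun j hj => ?_,
      by simp [Consistent], rfl⟩
    fin_cases j
    · exact hV 0 (by decide)
    · exact hV 1 (by decide)
    · exact hK
    all_goals exact absurd hj (by decide)
  · have hr := hq.2.1 Q.cond Q.keys
    refine ⟨⟨Q.frm, Q.cond, Q.keys, (q.group Q.cond Q.keys).repaired Q.having T.having,
        T.distinct, T.select⟩,
      valid_of_target hTv hF hQ.1 (hV 1 (by decide)) (fun e he => .inr (hQ.2.1 e he))
        (hV 2 (by decide)) (fun a ha => (hr.repaired_atoms ha).symm.imp_right (hQ.2.2.1 a)) _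
        hTv.2.2.2.1 fun e he => .inl he, fun j hj => ?_, by simp [Consistent], rfl⟩
    fin_cases j
    · exact hV 0 (by decide)
    · exact hV 1 (by decide)
    · exact hV 2 (by decide)
    · exact fun I hI g hg => hr.eval_repaired _ _ ⟨I, hI, g, hg, rfl⟩
    · exact absurd hj (by decide)
  · have hlen := QrHint.length_fixSelect (q.SameOnGroups Q.cond Q.keys) Q.select T.select
    refine ⟨⟨Q.frm, Q.cond, Q.keys, Q.having, T.distinct,
        QrHint.fixSelect (q.SameOnGroups Q.cond Q.keys) Q.select T.select⟩,
      valid_of_target hTv hF hQ.1 (hV 1 (by decide)) (fun e he => .inr (hQ.2.1 e he))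
        (hV 2 (by decide)) (fun a ha => .inr (hQ.2.2.1 a ha)) _ ?_ fun e he =>
          (QrHint.mem_fixSelect he).symm.imp_right (hQ.2.2.2.2 e), fun j hj => ?_,
      by simp [Consistent], rfl, rfl⟩
    · rw [← List.length_pos_iff, hlen, List.length_pos_iff]
      exact hTv.2.2.2.1
    · fin_cases j
      · exact hV 0 (by decide)
      · exact hV 1 (by decide)
      · exact hV 2 (by decide)
      · exact hV 3 (by decide)
      · exact ⟨rfl, hlen, fun I hI g hg => QrHint.eval_fixSelect_groups (hq.2.1 _ _) _ _ hI hg⟩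

theorem exists_equiv {ctx : Set AggInterp} (hctx : stdAgg ∈ ctx) {Qs : GroupedQuery S A}
    (hQs : Qs.Valid) (i : Fin 5) (Q T : GroupedQuery S A) (hQ : Q.Valid)
    (hT : i ≠ 0 → Qs.Unifies Q T) (hV : ∀ j ≤ i, Qs.Viable ctx T Q j) :
    ∃ Q' : GroupedQuery S A, Q'.Valid ∧ Q'.Equiv Qs ∧ Q.Consistent (i.val + 1) Q' := by
  by_cases hi : i = 0
  · subst hi
    obtain ⟨σ, hF⟩ := exists_perm_of_tables (hV 0 le_rfl) hQs.1.2.1 hQ.1.2.1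
    have hTv := hQs.rename σ.injective
    have hv := valid_of_target hTv hF (hTv.1.of_perm hF) (fun _ => Iff.rfl)
      (fun e he => .inl he) (fun _ _ _ _ => Iff.rfl) (fun a ha => .inl ha) Qs.distinct
      hTv.2.2.2.1 fun e he => .inl he
    refine ⟨_, hv, (equiv_of_viable hctx (Qs := Qs) (T := Qs.rename σ) hv hF.symm
      (fun _ => Iff.rfl) (fun _ _ _ _ => Iff.rfl) (fun _ _ _ _ => Iff.rfl)
      ⟨rfl, rfl, fun _ _ _ _ => rfl⟩).trans (rename_equiv hQs σ.injective),
      by simp [Consistent]⟩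
  obtain ⟨hTv, hF, hTQ⟩ := (hT hi).spec hQs hQ
  fin_cases i
  · exact absurd rfl hi
  · have hv := valid_of_target hTv hF hQ.1 (hV 1 le_rfl) (fun e he => .inl he)
      (fun _ _ _ _ => Iff.rfl) (fun a ha => .inl ha) T.distinct hTv.2.2.2.1 fun e he => .inl he
    exact ⟨_, hv, (equiv_of_viable hctx (Qs := Qs) hv hF.symm (hV 1 le_rfl)
      (fun _ _ _ _ => Iff.rfl) (fun _ _ _ _ => Iff.rfl)
      ⟨rfl, rfl, fun _ _ _ _ => rfl⟩).trans hTQ, by simp [Consistent]⟩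
  · have hv := valid_of_target hTv hF hQ.1 (hV 1 (by decide)) (fun e he => .inr (hQ.2.1 e he))
      (hV 2 le_rfl) (fun a ha => .inl ha) T.distinct hTv.2.2.2.1 fun e he => .inl he
    exact ⟨_, hv, (equiv_of_viable hctx (Qs := Qs) hv hF.symm (hV 1 (by decide))
      (hV 2 le_rfl) (fun _ _ _ _ => Iff.rfl)
      ⟨rfl, rfl, fun _ _ _ _ => rfl⟩).trans hTQ, by simp [Consistent]⟩
  · have hv := valid_of_target hTv hF hQ.1 (hV 1 (by decide)) (fun e he => .inr (hQ.2.1 e he))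
      (hV 2 (by decide)) (fun a ha => .inr (hQ.2.2.1 a ha)) T.distinct hTv.2.2.2.1
      fun e he => .inl he
    exact ⟨_, hv, (equiv_of_viable hctx (Qs := Qs) hv hF.symm (hV 1 (by decide))
      (hV 2 (by decide)) (hV 3 le_rfl)
      ⟨rfl, rfl, fun _ _ _ _ => rfl⟩).trans hTQ, by simp [Consistent]⟩
  · exact ⟨Q, hQ, (equiv_of_viable hctx hQ hF.symm (hV 1 (by decide)) (hV 2 (by decide))
      (hV 3 (by decide)) (hV 4 le_rfl)).trans hTQ, by simp [Consistent]⟩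

end GroupedQuery

end SQL

end

theorem theorem1 {S : SQL.Schema} {A : Type} [Infinite A]
    (ctx : Set SQL.AggInterp) (hctx : SQL.stdAgg ∈ ctx)
    (q : SQL.QrHint S A) (hq : q.Sound ctx) :
    (∀ Qs : SQL.FlatQuery S A, Qs.Valid → ∀ i : Fin 3,
      (∀ Q T : SQL.FlatQuery S A, Q.Valid → (i ≠ 0 → Qs.Unifies Q T) →
        (∀ j < i, Qs.Viable T Q j) → ¬ Qs.Viable T Q i →
        ∃ Q' : SQL.FlatQuery S A, Q'.Valid ∧ (∀ j ≤ i, Qs.Viable T Q' j) ∧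
          Q.Consistent i.val Q' ∧ Qs.FollowsHint q T Q Q' i) ∧
      (∀ Q T : SQL.FlatQuery S A, Q.Valid → (i ≠ 0 → Qs.Unifies Q T) →
        (∀ j ≤ i, Qs.Viable T Q j) →
        ∃ Q' : SQL.FlatQuery S A, Q'.Valid ∧ Q'.Equiv Qs ∧ Q.Consistent (i.val + 1) Q')) ∧
    (∀ Qs : SQL.GroupedQuery S A, Qs.Valid → ∀ i : Fin 5,
      (∀ Q T : SQL.GroupedQuery S A, Q.Valid → (i ≠ 0 → Qs.Unifies Q T) →
        (∀ j < i, Qs.Viable ctx T Q j) → ¬ Qs.Viable ctx T Q i →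
        ∃ Q' : SQL.GroupedQuery S A, Q'.Valid ∧ (∀ j ≤ i, Qs.Viable ctx T Q' j) ∧
          Q.Consistent i.val Q' ∧ Qs.FollowsHint q T Q Q' i) ∧
      (∀ Q T : SQL.GroupedQuery S A, Q.Valid → (i ≠ 0 → Qs.Unifies Q T) →
        (∀ j ≤ i, Qs.Viable ctx T Q j) →
        ∃ Q' : SQL.GroupedQuery S A, Q'.Valid ∧ Q'.Equiv Qs ∧
          Q.Consistent (i.val + 1) Q')) := by
  exact ⟨fun Qs hQs i => ⟨fun Q T hQ hT hV _ => SQL.FlatQuery.exists_fix hq hQs i Q T hQ hT hV,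
      fun Q T hQ hT hV => SQL.FlatQuery.exists_equiv hQs i Q T hQ hT hV⟩,
    fun Qs hQs i => ⟨fun Q T hQ hT hV _ => SQL.GroupedQuery.exists_fix hq hQs i Q T hQ hT hV,
      fun Q T hQ hT hV => SQL.GroupedQuery.exists_equiv hctx hQs i Q T hQ hT hV⟩⟩
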